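/- **Setting.** Let $\Upsilon=(0,\infty)$, $D\subseteq\mathbb R^d$, $\Omega=\Upsilon^{\mathbb N}\times\Upsilon^{\mathbb N}\times D$ with the product $\Sigma$ of the Borel $\sigma$-algebras. Let $W=(W_n)_{n\ge1}$, $X=(X_n)_{n\ge1}$ and $\Theta$ be the coordinate processes and the projection onto $D$. Put $T_n=\sum_{j\le n}W_j$ ($T_0=0$), $N_t=\#\{n\ge1:T_n\le t\}$, $S_t=\sum_{k=1}^{N_t}X_k$, and $\mathcal F_t=\sigma(\{S_s:s\le t\}\cup\{\Theta\})$ for $t\ge0$. A probability measure $Q$ on $\Sigma$ satisfies (a1) if $W$ and $X$ are $Q$-conditionally independent given $\Theta$, and (a2) if $\Theta$ and $X$ are $Q$-independent. For a family of probability distributions $L(\theta)$, $\theta\in D$, on $\Upsilon$, measurable in $\theta$, $S$ is a $Q$-CMRP$(L(\Theta))$ (compound mixed renewal process) if $X$ is $Q$-i.i.d., the processes $N$ and $X$ are $Q$-independent, the $W_n$ are $Q$-conditionally independent given $\Theta$, and $L(\Theta)$ is a $Q$-conditional distribution of $W_n$ given $\Theta$ for every $n$. For a distribution $l$ on $\Upsilon$,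 $S$ is a $Q$-CRP$(l)$ (compound renewal process) if $X$ is $Q$-i.i.d., $N$ and $X$ are $Q$-independent and the $W_n$ are $Q$-independent with distribution $l$. Measures $P,Q$ are progressively equivalent if they have the same null sets in $\mathcal F_t$ for every $t\ge0$. A regular conditional probability (rcp) of $Q$ over $Q_\Theta$ consistent with $\Theta$ is a family $(Q_\theta)_{\theta\in D}$ of probability measures on $\Sigma$ such that $\theta\mapsto Q_\theta(E)$ is measurable and $\int Q_\theta(E)\,Q_\Theta(d\theta)=Q(E)$ for all $E\in\Sigma$, and, for every Borel set $B\subseteq D$, $Q_\theta(\Theta\in B)=1$ for $Q_\Theta$-a.e. $\theta\in B$. Let $K(\theta)$ and $\Lambda(\rho(\theta))$, $\theta\in D$, be probability distributions on $\Upsilon$ depending measurably on $\theta$, where $\rho:D\to\mathbb R^k$ is measurable; their distribution functions are denoted by the same letters. Let $P$ be a probability measure on $\Sigma$ that satisfies (a1), (a2) and makes $S$ a $P$-CMRP$(K(\Theta))$, and let $(P_\theta)_{\theta\in D}$ be an rcp of $P$ over $P_\Theta$ consistent with $\Theta$. Fix a jointly measurable version of the Radon-Nikodym derivatives $\frac{d\Lambda(\rho(\theta))}{dK(\theta)}(w)$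 (of the absolutely continuous parts, if necessary). Let $h:\Upsilon\to\mathbb R$ be measurable and injective. * $\mathcal M_{S,\Lambda(\rho(\Theta))}$ is the class of all probability measures $Q$ on $\Sigma$ that satisfy (a1) and (a2), are progressively equivalent to $P$, and make $S$ a $Q$-CMRP$(\Lambda(\rho(\Theta)))$. * $\mathcal M_{S,\Lambda(\rho(\theta))}$ is the class of all probability measures on $\Sigma$ that are progressively equivalent to $P_\theta$ and make $S$ a CRP$(\Lambda(\rho(\theta)))$. * $\mathcal F_{P,h}$ is the class of all measurable $\gamma:\Upsilon\to\mathbb R$ with values in the range of $h$ and $\mathbb E_P[h^{-1}(\gamma(X_1))]=1$. * $\mathcal R_+(D)$ is the class of all measurable $\xi:D\to\mathbb R$ with $P_\Theta(\xi>0)=1$ and $\mathbb E_P[\xi(\Theta)]=1$. For $\gamma\in\mathcal F_{P,h}$, $\xi\in\mathcal R_+(D)$, $t\ge0$ put $$\widetilde M_t^{(\gamma)}(\theta)=\Big[\prod_{j=1}^{N_t}h^{-1}(\gamma(X_j))\,\frac{d\Lambda(\rho(\theta))}{dK(\theta)}(W_j)\Big]\cdot\frac{1-\Lambda(\rho(\theta))(t-T_{N_t})}{1-K(\theta)(t-T_{N_t})},\qquad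 M_t^{(\gamma)}(\Theta)=\xi(\Theta)\,\widetilde M_t^{(\gamma)}(\Theta),$$ and consider, for a probability measure $Q$ and for $\theta\in D$, the conditions $$Q(A)=\int_A M_t^{(\gamma)}(\Theta)\,dP\quad\text{for all }0\le u\le t,\ A\in\mathcal F_u,\tag{1}$$ $$Q_\theta(A)=\int_A \widetilde M_t^{(\gamma)}(\theta)\,dP_\theta\quad\text{for all }0\le u\le t,\ A\in\mathcal F_u.\tag{2}$$ **Theorem.** (i) For every $Q\in\mathcal M_{S,\Lambda(\rho(\Theta))}$ there is a pair $(\gamma,\xi)\in\mathcal F_{P,h}\times\mathcal R_+(D)$ satisfying (1), with $\xi$ a Radon-Nikodym derivative of $Q_\Theta$ with respect to $P_\Theta$. The pair is essentially unique: if $(\gamma',\xi')\in\mathcal F_{P,h}\times\mathcal R_+(D)$ also satisfies (1), then $\gamma'=\gamma$ $P_{X_1}$-a.s. and $\xi'=\xi$ $P_\Theta$-a.s. (ii) Conversely, suppose that $\Lambda(\rho(\theta))$ and $K(\theta)$ are equivalent for $P_\Theta$-a.e. $\theta$. Then for every pair $(\gamma,\xi)\in\mathcal F_{P,h}\times\mathcal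 R_+(D)$ there is a $Q\in\mathcal M_{S,\Lambda(\rho(\Theta))}$ satisfying (1), and it is the only probability measure on $\Sigma$ satisfying (1). (iii) In both cases, i.e. whenever $Q\in\mathcal M_{S,\Lambda(\rho(\Theta))}$ and $(\gamma,\xi)\in\mathcal F_{P,h}\times\mathcal R_+(D)$ satisfy (1), there is an rcp $(Q_\theta)_{\theta\in D}$ of $Q$ over $Q_\Theta$ consistent with $\Theta$, essentially unique (any other one coincides with it for $Q_\Theta$-a.e. $\theta$), such that for $P_\Theta$-a.e. $\theta$ both $Q_\theta\in\mathcal M_{S,\Lambda(\rho(\theta))}$ and (2) hold. -/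

import Mathlib

open MeasureTheory ProbabilityTheory
open scoped NNReal ENNReal

noncomputable section

namespace CMRP

/-- The half line `Υ = (0,∞)` with its Borel `σ`-algebra. -/
abbrev Υ : Type := Set.Ioi (0 : ℝ)

/-- The canonical space `Υ^ℕ × Υ^ℕ × D` with its product `σ`-algebra. -/
abbrev Path {d : ℕ} (D : Set (Fin d → ℝ)) : Type := (ℕ → Υ) × (ℕ → Υ) × D

variable {d : ℕ} {D : Set (Fin d → ℝ)}

/-! ### The canonical processes (sequences indexed from `1` in the mathematics start at `0` here) -/

/-- Interarrival times: `W n` is the interarrival time number `n + 1`. -/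
def W (n : ℕ) (ω : Path D) : Υ := ω.1 n

/-- Claim sizes: `X n` is the claim size number `n + 1`. -/
def X (n : ℕ) (ω : Path D) : Υ := ω.2.1 n

/-- The mixing parameter, i.e. the projection onto `D`. -/
def Θ (ω : Path D) : D := ω.2.2

/-- Arrival times: `T n` is the sum of the first `n` interarrival times, `T 0 = 0`. -/
def T (n : ℕ) (ω : Path D) : ℝ := ∑ j ∈ Finset.range n, (W j ω : ℝ)

/-- The counting process: the number of arrivals (of index at least one) up to time `t`;
it is `⊤` after an explosion. -/
def N (t : ℝ≥0) (ω : Path D) : ℕ∞ := {n : ℕ | T (n + 1) ω ≤ (t : ℝ)}.encard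

/-- The aggregate claims process, the sum of the claims that arrived up to time `t`.
Its values are taken in `[0,∞]`, which only matters after an explosion. -/
def S (t : ℝ≥0) (ω : Path D) : ℝ≥0∞ :=
  ∑' n : ℕ, {n : ℕ | T (n + 1) ω ≤ (t : ℝ)}.indicator
    (fun n => ENNReal.ofReal (X n ω : ℝ)) n

/-- The `σ`-algebra generated by `Θ`. -/
@[reducible] def sigmaTheta (D : Set (Fin d → ℝ)) : MeasurableSpace (Path D) :=
  MeasurableSpace.comap Θ inferInstance

/-- The canonical filtration of `S` and `Θ`: at time `t` it is generated by `Θ` and by the `S s`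
with `s ≤ t`. -/
@[reducible] def F (D : Set (Fin d → ℝ)) (t : ℝ≥0) : MeasurableSpace (Path D) :=
  (⨆ s : ℝ≥0, ⨆ _ : s ≤ t, MeasurableSpace.comap (S s) inferInstance) ⊔ sigmaTheta D

/-! ### Conditioning on `Θ` -/

/-- A version of the conditional probability of `A` given `σ(Θ)`. -/
def condProb (P : Measure (Path D)) (A : Set (Path D)) : Path D → ℝ :=
  P[A.indicator (fun _ => (1 : ℝ)) | sigmaTheta D]

/-- The interarrival process is conditionally independent given `Θ`. -/
def CondIndepInterarrivals (P : Measure (Path D)) : Prop :=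
  ∀ (n : ℕ) (v : ℕ → ℝ),
    condProb P {ω | ∀ k < n, (W k ω : ℝ) ≤ v k} =ᵐ[P]
      fun ω => ∏ k ∈ Finset.range n, condProb P {ω' | (W k ω' : ℝ) ≤ v k} ω

/-- Condition (a1): the processes `W` and `X` are conditionally independent given `Θ`. -/
def CondIndepWX (P : Measure (Path D)) : Prop :=
  ∀ A B : Set (ℕ → Υ), MeasurableSet A → MeasurableSet B →
    condProb P {ω | (fun n => W n ω) ∈ A ∧ (fun n => X n ω) ∈ B} =ᵐ[P]
      fun ω => condProb P {ω' | (fun n => W n ω') ∈ A} ω *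
        condProb P {ω' | (fun n => X n ω') ∈ B} ω

/-- Condition (a2): `Θ` and the process `X` are independent. -/
def IndepThetaX (P : Measure (Path D)) : Prop :=
  IndepFun (fun ω : Path D => Θ ω) (fun ω n => X n ω) P

/-! ### Renewal processes -/

/-- `(N, X)` is a risk process: `X` is i.i.d. and the processes `N` and `X` are independent. -/
structure IsRiskProcess (P : Measure (Path D)) : Prop where
  indep_claims : iIndepFun (fun n (ω : Path D) => X n ω) P
  ident_claims : ∀ n, IdentDistrib (X n : Path D → Υ) (X 0) P P
  indep_N_X : IndepFun (fun (ω : Path D) (t : ℝ≥0) => N t ω) (fun ω n => X n ω) P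

/-- `N` is a mixed renewal process with interarrival time conditional distribution `L(Θ)`: the
interarrival times are conditionally independent given `Θ`, and `L(Θ)` is a conditional
distribution over `Θ` of each of them. -/
structure IsMRP (P : Measure (Path D)) (L : D → Measure Υ) : Prop where
  condIndep : CondIndepInterarrivals P
  condDistrib : ∀ (n : ℕ) (B : Set Υ), MeasurableSet B →
    condProb P {ω | W n ω ∈ B} =ᵐ[P] fun ω => (L (Θ ω)).real B

/-- `S` is a compound mixed renewal process with interarrival time conditional
distribution `L(Θ)` (and claim size distribution the law of `X 0`). -/
structure IsCMRP (P : Measure (Path D)) (L : D → Measure Υ) : Prop where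
  risk : IsRiskProcess P
  mrp : IsMRP P L

/-- `S` is a compound renewal process with interarrival time distribution `l`
(and claim size distribution the law of `X 0`). -/
structure IsCRP (P : Measure (Path D)) (l : Measure Υ) : Prop where
  risk : IsRiskProcess P
  indep : iIndepFun (fun n (ω : Path D) => W n ω) P
  law : ∀ n, P.map (W n) = l

/-! ### Regular conditional probabilities -/

/-- `p` is a regular conditional probability of `P` over the law of `Θ` under `P` that is
consistent with `Θ`. -/
structure IsConsistentRCP (P : Measure (Path D)) (p : D → Measure (Path D)) : Prop where
  prob : ∀ θ, IsProbabilityMeasure (p θ)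
  meas : ∀ E : Set (Path D), MeasurableSet E → Measurable fun θ => p θ E
  disint : ∀ E : Set (Path D), MeasurableSet E → ∫⁻ θ, p θ E ∂(P.map Θ) = P E
  consistent : ∀ B : Set D, MeasurableSet B →
    ∀ᵐ θ ∂(P.map Θ), θ ∈ B → p θ (Θ ⁻¹' B) = 1

/-! ### Classes of measures and of functions -/

/-- `Q` and `P` are equivalent on each member of the filtration. -/
def ProgEquiv (Q P : Measure (Path D)) : Prop :=
  ∀ (t : ℝ≥0) (A : Set (Path D)), MeasurableSet[F D t] A → (Q A = 0 ↔ P A = 0)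

/-- The class of all probability measures `Q` that satisfy (a1) and (a2), are progressively
equivalent to `P`, and under which `S` is a compound mixed renewal process with interarrival
time conditional distribution `L(Θ)`. -/
structure MemM (P : Measure (Path D)) (L : D → Measure Υ) (Q : Measure (Path D)) : Prop where
  prob : IsProbabilityMeasure Q
  a1 : CondIndepWX Q
  a2 : IndepThetaX Q
  progEquiv : ProgEquiv Q P
  cmrp : IsCMRP Q L

/-- The class of all probability measures `q` that are progressively equivalent to `p` and under
which `S` is a compound renewal process with interarrival time distribution `l`. -/
structure MemMFiber (p : Measure (Path D)) (l : Measure Υ) (q : Measure (Path D)) : Prop where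
  prob : IsProbabilityMeasure q
  progEquiv : ProgEquiv q p
  crp : IsCRP q l

/-- The inverse `h⁻¹` on the range of an injective `h` (it is used only there). -/
def hInv (h : Υ → ℝ) (y : ℝ) : ℝ := ((Function.invFun h y : Υ) : ℝ)

/-- The class `𝓕_{P,h}`; the range condition says that `h⁻¹ ∘ γ` is defined. -/
structure MemF (P : Measure (Path D)) (h : Υ → ℝ) (γ : Υ → ℝ) : Prop where
  meas : Measurable γ
  range : ∀ x, γ x ∈ Set.range h
  integrable : Integrable (fun ω : Path D => hInv h (γ (X 0 ω))) P
  expectation : ∫ ω : Path D, hInv h (γ (X 0 ω)) ∂P = 1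

/-- The class `𝓡₊(D)`. -/
structure MemR (P : Measure (Path D)) (ξ : D → ℝ) : Prop where
  meas : Measurable ξ
  pos : ∀ᵐ θ ∂(P.map Θ), 0 < ξ θ
  integrable : Integrable (fun ω : Path D => ξ (Θ ω)) P
  expectation : ∫ ω : Path D, ξ (Θ ω) ∂P = 1

/-! ### The densities -/

/-- The distribution function of a distribution on `(0,∞)`. -/
def distFun (l : Measure Υ) (x : ℝ) : ℝ := l.real {w : Υ | (w : ℝ) ≤ x}

/-- A jointly measurable version `r` of the Radon-Nikodym derivatives `dL(θ)/dK(θ)`,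
for `m`-almost every `θ`. -/
structure IsDerivVersion (m : Measure D) (L K : D → Measure Υ) (r : D → Υ → ℝ) : Prop where
  meas : Measurable (Function.uncurry r)
  ae_eq : ∀ᵐ θ ∂m, r θ =ᵐ[K θ] fun w => ((L θ).rnDeriv (K θ) w).toReal

/-- The density `M̃_t^{(γ)}(θ)` of the fibre measures. -/
def densFiber (h γ : Υ → ℝ) (r : D → Υ → ℝ) (L K : D → Measure Υ) (θ : D) (t : ℝ≥0)
    (ω : Path D) : ℝ :=
  (∏ j ∈ Finset.range (N t ω).toNat, hInv h (γ (X j ω)) * r θ (W j ω)) *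
    ((1 - distFun (L θ) ((t : ℝ) - T (N t ω).toNat ω)) /
      (1 - distFun (K θ) ((t : ℝ) - T (N t ω).toNat ω)))

/-- The density `M_t^{(γ)}(Θ) = ξ(Θ) M̃_t^{(γ)}(Θ)`. -/
def dens (h γ : Υ → ℝ) (ξ : D → ℝ) (r : D → Υ → ℝ) (L K : D → Measure Υ) (t : ℝ≥0)
    (ω : Path D) : ℝ :=
  ξ (Θ ω) * densFiber h γ r L K (Θ ω) t ω

/-- `Q(A) = ∫_A M_t dP` for all `0 ≤ u ≤ t` and all `A ∈ F_u`. -/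
def HasProgDensity (Q P : Measure (Path D)) (M : ℝ≥0 → Path D → ℝ) : Prop :=
  ∀ u t : ℝ≥0, u ≤ t → Integrable (M t) P ∧
    ∀ A : Set (Path D), MeasurableSet[F D u] A → Q.real A = ∫ ω in A, M t ω ∂P

end CMRP

end

/-! Conditions (a1), (a2) and the mixed renewal property leave no freedom beyond three ingredients:
the law `m` of `Θ`, the interarrival kernel, and the claim law `μ`. Such a measure is the mixture
over `m` of product measures `fiber`, in which the interarrival times are i.i.d., the claims are
i.i.d. and `Θ` is frozen (`IsCMRP.eq_model`). Hence `P`, and every `Q` in the class, is a `model`.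

Two models are compared through the first claim. The events up to time `t` see `Θ`, `W 0` and `X 0`
on `{W 0 ≤ t}`, so progressive equivalence forces the parameter laws, the claim laws and almost all
interarrival laws to be equivalent (`ProgAC.of_model`). Then `ξ` is the density of the parameter
laws, and `γ` is `h` applied to the density of the claim laws.

The density formula is proved fibrewise (`fiber_apply_eq_setLIntegral`). On `{N t = n}` an event of
`F D t` depends only on `Θ` and the first `n` interarrival times and claims. The next interarrival
time enters only by exceeding `t - T n`, and integrating it out gives a tail probability. The first
`n` variables contribute the product of densities, and the ratio of tails corrects the last factor.
Integrating over `θ` yields the mixed formula.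

Uniqueness rests on the filtration generating the whole `σ`-algebra (`iSup_F_eq`): a prescribed
density process determines `Q`, so `Q` is the model built from `(γ, ξ)`, and its marginals determine
the pair almost everywhere. Its fibres are the required regular conditional probability, unique by
`IsConsistentRCP.ae_eq`. -/

namespace CMRP

/-! ### Infinite product measures: resampling a coordinate and changing finitely many factors. -/

section InfiniteProducts

theorem lintegral_prod_infinitePi {ι : Type*} {E : ι → Type*} [∀ i, MeasurableSpace (E i)]
    (ν : (i : ι) → Measure (E i)) [∀ i, IsProbabilityMeasure (ν i)]
    (s : Finset ι) {f : (i : ι) → E i → ℝ≥0∞} (hf : ∀ i, Measurable (f i)) :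
    ∫⁻ w, ∏ i ∈ s, f i (w i) ∂Measure.infinitePi ν = ∏ i ∈ s, ∫⁻ u, f i u ∂ν i := by
  refine (lintegral_prod_eq_prod_lintegral_of_indepFun s (fun i (w : ∀ i, E i) => f i (w i))
    (iIndepFun_infinitePi hf) fun i => (hf i).comp (measurable_pi_apply i)).trans ?_
  refine Finset.prod_congr rfl fun i _ => ?_
  rw [← lintegral_map (hf i) (measurable_pi_apply i), Measure.infinitePi_map_eval]

variable {ι : Type*} [DecidableEq ι] {E : ι → Type*} [∀ i, MeasurableSpace (E i)]

/-- Resampling one coordinate independently does not change a product measure. -/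
theorem map_update_infinitePi (ν : (i : ι) → Measure (E i)) [∀ i, IsProbabilityMeasure (ν i)]
    (n : ι) :
    ((Measure.infinitePi ν).prod (ν n)).map (fun q => Function.update q.1 n q.2) =
      Measure.infinitePi ν := by
  refine Measure.eq_infinitePi ν fun s t ht => ?_
  have hm : Measurable fun q : (∀ i, E i) × E n => Function.update q.1 n q.2 := by
    refine measurable_pi_lambda _ fun i => ?_
    by_cases h : i = n
    · subst h; simpa using measurable_snd
    · simpa [Function.update_of_ne h, Function.comp_def] using
        (measurable_pi_apply i).comp measurable_fst
  rw [Measure.map_apply hm (.pi s.countable_toSet fun i _ => ht i)]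
  have key : (fun q : (∀ i, E i) × E n => Function.update q.1 n q.2) ⁻¹' (Set.pi s t) =
      (Set.pi (s.erase n : Finset ι) t) ×ˢ (if n ∈ s then t n else Set.univ) := by
    ext ⟨w, u⟩
    simp only [Set.mem_preimage, Set.mem_pi, Finset.mem_coe, Set.mem_prod, Finset.mem_erase]
    constructor
    · intro h
      refine ⟨fun i hi => by simpa [Function.update_of_ne hi.1] using h i hi.2, ?_⟩
      split_ifs with hn
      · simpa using h n hn
      · trivial
    · rintro ⟨h1, h2⟩ i hi
      by_cases h : i = n
      · subst h; simpa [hi] using h2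
      · simpa [Function.update_of_ne h] using h1 i ⟨h, hi⟩
  rw [key, Measure.prod_prod, Measure.infinitePi_pi _ fun i _ => ht i]
  split_ifs with hn
  · rw [mul_comm, Finset.mul_prod_erase s (fun i => ν i (t i)) hn]
  · rw [measure_univ, mul_one, Finset.erase_eq_of_notMem hn]

/-- Fubini for a single coordinate of an infinite product; it will integrate out the first
interarrival time that overshoots `t`. -/
theorem lintegral_infinitePi_eq_lintegral_update (ν : (i : ι) → Measure (E i))
    [∀ i, IsProbabilityMeasure (ν i)] (n : ι) {f : (∀ i, E i) → ℝ≥0∞} (hf : Measurable f) :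
    ∫⁻ w, f w ∂Measure.infinitePi ν =
      ∫⁻ w, ∫⁻ u, f (Function.update w n u) ∂ν n ∂Measure.infinitePi ν := by
  have hm : Measurable fun q : (∀ i, E i) × E n => Function.update q.1 n q.2 := by
    refine measurable_pi_lambda _ fun i => ?_
    by_cases h : i = n
    · subst h; simpa using measurable_snd
    · simpa [Function.update_of_ne h, Function.comp_def] using
        (measurable_pi_apply i).comp measurable_fst
  conv_lhs => rw [← map_update_infinitePi ν n]
  rw [lintegral_map hf hm]
  exact lintegral_prod _ (hf.comp hm).aemeasurable

/-- Changing finitely many factors by densities amounts to the product density. -/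
theorem infinitePi_eq_withDensity (ν ν' : (i : ι) → Measure (E i))
    [∀ i, IsProbabilityMeasure (ν i)] [∀ i, IsProbabilityMeasure (ν' i)] (s : Finset ι)
    {g : (i : ι) → E i → ℝ≥0∞} (hg : ∀ i, Measurable (g i))
    (h1 : ∀ i ∈ s, ν' i = (ν i).withDensity (g i)) (h2 : ∀ i ∉ s, ν' i = ν i) :
    Measure.infinitePi ν' = (Measure.infinitePi ν).withDensity fun w => ∏ i ∈ s, g i (w i) := by
  refine (Measure.eq_infinitePi ν' fun a t ht => ?_).symm
  have hbox : MeasurableSet (Set.pi (a : Set ι) t) := .pi a.countable_toSet fun i _ => ht i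
  rw [withDensity_apply _ hbox, ← lintegral_indicator hbox]
  -- Indicator of the box and density are merged into one factor per coordinate, so that the
  -- integral splits over `a ∪ s`.
  let F : (i : ι) → E i → ℝ≥0∞ := fun i u =>
    (if i ∈ a then (t i).indicator 1 u else 1) * (if i ∈ s then g i u else 1)
  have hF : ∀ i, Measurable (F i) := fun i => by
    refine Measurable.mul ?_ ?_
    · by_cases h : i ∈ a
      · simpa [h] using measurable_one.indicator (ht i)
      · simp [h]
    · by_cases h : i ∈ s
      · simpa [h] using hg i
      · simp [h]
  have key : ∀ w : ∀ i, E i, (Set.pi (a : Set ι) t).indicator (fun w => ∏ i ∈ s, g i (w i)) w =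
      ∏ i ∈ a ∪ s, F i (w i) := by
    intro w
    simp only [F, Finset.prod_mul_distrib]
    have e1 : ∏ i ∈ a ∪ s, (if i ∈ s then g i (w i) else 1) = ∏ i ∈ s, g i (w i) := by
      rw [← Finset.prod_filter]; congr 1; ext; simp +contextual
    have e2 : ∏ i ∈ a ∪ s, (if i ∈ a then (t i).indicator (1 : E i → ℝ≥0∞) (w i) else 1) =
        ∏ i ∈ a, (t i).indicator (1 : E i → ℝ≥0∞) (w i) := by
      rw [← Finset.prod_filter]; congr 1; ext; simp +contextual
    rw [e1, e2]
    by_cases hw : w ∈ Set.pi (a : Set ι) t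
    · rw [Set.indicator_of_mem hw, Finset.prod_eq_one (s := a), one_mul]
      intro i hi
      simp [Set.indicator_of_mem (hw i hi)]
    · rw [Set.indicator_of_notMem hw]
      simp only [Set.mem_pi, not_forall] at hw
      obtain ⟨i, hi, hi'⟩ := hw
      rw [Finset.prod_eq_zero (i := i) (by simpa using hi) (Set.indicator_of_notMem hi' _),
        zero_mul]
  simp_rw [key]
  rw [lintegral_prod_infinitePi ν (a ∪ s) hF]
  have : ∏ i ∈ a, ν' i (t i) = ∏ i ∈ a ∪ s, (if i ∈ a then ν' i (t i) else 1) := by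
    rw [← Finset.prod_filter]; congr 1; ext; simp +contextual
  rw [this]
  refine Finset.prod_congr rfl fun i hi => ?_
  have hν' : ν' i = (ν i).withDensity (fun u => if i ∈ s then g i u else 1) := by
    by_cases h : i ∈ s
    · simpa [h] using h1 i h
    · simpa [h] using h2 i h
  by_cases hia : i ∈ a
  · simp only [F, hia, if_true]
    rw [hν', withDensity_apply _ (ht i), ← lintegral_indicator (ht i)]
    refine lintegral_congr fun u => ?_
    by_cases hu : u ∈ t i <;> simp [hu]
  -- A coordinate of `s` outside the box contributes the full integral of its density, which is `1`.
  · have := measure_univ (μ := ν' i)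
    rw [hν', withDensity_apply _ .univ, Measure.restrict_univ] at this
    simpa [F, hia] using this

/-- The integral of a function of finitely many coordinates only depends on their laws. -/
theorem lintegral_infinitePi_congr (ν ν' : (i : ι) → Measure (E i))
    [∀ i, IsProbabilityMeasure (ν i)] [∀ i, IsProbabilityMeasure (ν' i)] (s : Finset ι)
    (h : ∀ i ∈ s, ν i = ν' i) {f : (∀ i, E i) → ℝ≥0∞} (hf : Measurable f)
    (hfs : ∀ w w' : ∀ i, E i, (∀ i ∈ s, w i = w' i) → f w = f w') :
    ∫⁻ w, f w ∂Measure.infinitePi ν = ∫⁻ w, f w ∂Measure.infinitePi ν' := by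
  -- An arbitrary base point fills the coordinates outside `s`, which exhibits `f` as a function of
  -- the restriction to `s`.
  obtain ⟨x⟩ : Nonempty (∀ i, E i) := nonempty_of_isProbabilityMeasure (Measure.infinitePi ν)
  let g : (∀ i : s, E i) → ℝ≥0∞ := fun y => f (Function.updateFinset x s y)
  have hg : Measurable g := hf.comp measurable_updateFinset
  have hfg : ∀ w, f w = g (s.restrict w) := fun w =>
    hfs _ _ fun i hi => by simp [Function.updateFinset, hi]
  simp_rw [hfg]
  rw [lintegral_restrict_infinitePi ν hg, lintegral_restrict_infinitePi ν' hg]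
  congr 2
  ext1 i
  exact h i i.2

end InfiniteProducts

/-- The law of an i.i.d. sequence depends measurably on the law of its members. -/
theorem measurable_infinitePi {α E : Type*} [MeasurableSpace α] [MeasurableSpace E]
    {L : α → Measure E} (hL : Measurable L) [∀ a, IsProbabilityMeasure (L a)] :
    Measurable fun a => Measure.infinitePi fun _ : ℕ => L a := by
  refine Measurable.measure_of_isPiSystem_of_isProbabilityMeasure
    (S := squareCylinders fun _ : ℕ => {s : Set E | MeasurableSet s})
    generateFrom_squareCylinders.symm
    (isPiSystem_squareCylinders (fun _ => MeasurableSpace.isPiSystem_measurableSet)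
      fun _ => .univ) ?_
  rintro _ ⟨s, t, ht, rfl⟩
  have ht' : ∀ i, MeasurableSet (t i) := fun i => ht i (Set.mem_univ i)
  simp_rw [Measure.infinitePi_pi _ fun i (_ : i ∈ s) => ht' i]
  exact Finset.measurable_prod _ fun i _ => (Measure.measurable_coe (ht' i)).comp hL

variable {d : ℕ} {D : Set (Fin d → ℝ)}

/-! ### Paths -/

@[fun_prop]
theorem measurable_W (n : ℕ) : Measurable (W n : Path D → Υ) := by unfold W; fun_prop

@[fun_prop]
theorem measurable_X (n : ℕ) : Measurable (X n : Path D → Υ) := by unfold X; fun_prop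

@[fun_prop]
theorem measurable_Θ : Measurable (Θ : Path D → D) := by unfold Θ; fun_prop

@[fun_prop]
theorem measurable_T (n : ℕ) : Measurable (T n : Path D → ℝ) := by unfold T; fun_prop

theorem T_succ (n : ℕ) (ω : Path D) : T (n + 1) ω = T n ω + (W n ω : ℝ) :=
  Finset.sum_range_succ _ _

theorem T_strictMono (ω : Path D) : StrictMono fun n => T n ω :=
  strictMono_nat_of_lt_succ fun n => by
    rw [T_succ]; exact lt_add_of_pos_right _ (W n ω).2

theorem X_pos (n : ℕ) (ω : Path D) : 0 < (X n ω : ℝ) := (X n ω).2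

theorem T_zero (ω : Path D) : T 0 ω = 0 := by simp [T]

theorem T_one (ω : Path D) : T 1 ω = (W 0 ω : ℝ) := by simp [T]

/-- Arrival times increase strictly, so the arrivals up to `t` form an initial segment; index `m`
stands for the arrival at time `T (m + 1)`. -/
theorem setOf_T_le_eq {t : ℝ≥0} {n : ℕ} {ω : Path D} (h1 : T n ω ≤ t) (h2 : (t : ℝ) < T (n + 1) ω) :
    {m : ℕ | T (m + 1) ω ≤ (t : ℝ)} = Finset.range n := by
  ext m
  simp only [Set.mem_ofPred_eq, Finset.coe_range, Set.mem_Iio]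
  constructor
  · intro hm
    have := (T_strictMono ω).lt_iff_lt.1 (hm.trans_lt h2)
    omega
  · intro hm
    exact ((T_strictMono ω).monotone hm).trans h1

theorem N_eq_coe_iff {t : ℝ≥0} {n : ℕ} {ω : Path D} :
    N t ω = n ↔ T n ω ≤ t ∧ (t : ℝ) < T (n + 1) ω := by
  constructor
  · intro h
    have hfin : {m : ℕ | T (m + 1) ω ≤ (t : ℝ)}.Finite :=
      Set.finite_of_encard_eq_coe h
    have hex : ∃ m, (t : ℝ) < T (m + 1) ω := by
      by_contra! hc
      exact Set.infinite_univ (hfin.subset fun m _ => hc m)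
    classical
    have hm := Nat.find_spec hex
    have hm' : T (Nat.find hex) ω ≤ t := by
      rcases Nat.eq_zero_or_pos (Nat.find hex) with h0 | h0
      · rw [h0, T_zero]; exact t.2
      · have := Nat.find_min hex (Nat.sub_lt h0 one_pos)
        rwa [Nat.sub_add_cancel (show 1 ≤ Nat.find hex from h0), not_lt] at this
    have : N t ω = (Nat.find hex : ℕ) := by
      rw [N, setOf_T_le_eq hm' hm, Set.encard_coe_eq_coe_finsetCard, Finset.card_range]
    rw [this] at h
    rw [← Nat.cast_injective h]
    exact ⟨hm', hm⟩
  · rintro ⟨h1, h2⟩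
    rw [N, setOf_T_le_eq h1 h2, Set.encard_coe_eq_coe_finsetCard, Finset.card_range]

theorem N_eq_top_iff {t : ℝ≥0} {ω : Path D} : N t ω = ⊤ ↔ ∀ n, T n ω ≤ t := by
  constructor
  · intro h n
    by_contra hc
    have hfin : {m : ℕ | T (m + 1) ω ≤ (t : ℝ)}.Finite := by
      refine (Set.finite_lt_nat n).subset fun m hm => ?_
      by_contra hmn
      have h1 := (T_strictMono ω).monotone (show n ≤ m + 1 by simp at hmn; omega)
      exact hc (h1.trans hm)
    rw [N, Set.encard_eq_top_iff] at h
    exact h hfin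
  · intro h
    rw [N, Set.encard_eq_top_iff]
    have : {m : ℕ | T (m + 1) ω ≤ (t : ℝ)} = Set.univ := by ext m; simpa using h (m + 1)
    rw [this]; exact Set.infinite_univ

theorem S_eq_sum {t : ℝ≥0} {n : ℕ} {ω : Path D} (h1 : T n ω ≤ t) (h2 : (t : ℝ) < T (n + 1) ω) :
    S t ω = ∑ k ∈ Finset.range n, ENNReal.ofReal (X k ω : ℝ) := by
  rw [S, setOf_T_le_eq h1 h2]
  rw [← tsum_subtype (Finset.range n : Set ℕ) fun k => ENNReal.ofReal (X k ω : ℝ)]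
  exact Finset.tsum_subtype (Finset.range n) fun k => ENNReal.ofReal (X k ω : ℝ)

/-- Unlike `S_eq_sum`, this bound needs no information on the next arrival and therefore holds for
exploding paths too. -/
theorem sum_le_S {t : ℝ≥0} {n : ℕ} {ω : Path D} (h : T n ω ≤ t) :
    ∑ k ∈ Finset.range n, ENNReal.ofReal (X k ω : ℝ) ≤ S t ω := by
  refine le_trans (Finset.sum_le_sum fun k hk => ?_) (ENNReal.sum_le_tsum (Finset.range n))
  rw [Set.indicator_of_mem]
  exact ((T_strictMono ω).monotone (Finset.mem_range.1 hk)).trans h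

/-- Claims are strictly positive, so `S` becomes positive exactly at the first arrival. This makes
`W 0` visible in the filtration. -/
theorem S_pos_iff {t : ℝ≥0} {ω : Path D} : 0 < S t ω ↔ (W 0 ω : ℝ) ≤ t := by
  constructor
  · intro h
    by_contra hc
    rw [S_eq_sum (n := 0) (by rw [T_zero]; exact t.2) (by simpa [T_one] using hc)] at h
    simp at h
  · intro h
    refine lt_of_lt_of_le ?_ (sum_le_S (n := 1) (by rwa [T_one]))
    simpa using X_pos 0 ω

theorem measurableSet_N_eq (t : ℝ≥0) (n : ℕ∞) : MeasurableSet {ω : Path D | N t ω = n} := by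
  induction n using ENat.recTopCoe with
  | top =>
    simp_rw [N_eq_top_iff, Set.ofPred_forall]
    exact .iInter fun n => measurableSet_le (measurable_T n) measurable_const
  | coe n =>
    simp_rw [N_eq_coe_iff]
    exact (measurableSet_le (measurable_T n) measurable_const).inter
      (measurableSet_lt measurable_const (measurable_T _))

@[fun_prop]
theorem measurable_S (t : ℝ≥0) : Measurable (S t : Path D → ℝ≥0∞) := by
  unfold S
  refine Measurable.tsum fun n => ?_
  have : (fun ω : Path D => {n : ℕ | T (n + 1) ω ≤ (t : ℝ)}.indicator
      (fun n => ENNReal.ofReal (X n ω : ℝ)) n) =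
      {ω : Path D | T (n + 1) ω ≤ (t : ℝ)}.indicator
        fun ω => ENNReal.ofReal (X n ω : ℝ) := by
    ext ω; simp [Set.indicator]
  rw [this]
  exact Measurable.indicator (by fun_prop) (measurableSet_le (measurable_T _) measurable_const)

/-! ### The filtration -/

theorem sigmaTheta_le : sigmaTheta D ≤ (inferInstance : MeasurableSpace (Path D)) :=
  measurable_Θ.comap_le

theorem F_le (t : ℝ≥0) : F D t ≤ (inferInstance : MeasurableSpace (Path D)) :=
  sup_le (iSup_le fun s => iSup_le fun _ => (measurable_S s).comap_le) sigmaTheta_le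

theorem F_mono {s t : ℝ≥0} (h : s ≤ t) : F D s ≤ F D t :=
  sup_le_sup_right (biSup_mono fun _ hu => hu.trans h) _

theorem measurable_F_Θ (t : ℝ≥0) : Measurable[F D t] (Θ : Path D → D) :=
  (comap_measurable _).mono le_sup_right le_rfl

theorem measurable_F_S {s t : ℝ≥0} (h : s ≤ t) : Measurable[F D t] (S s : Path D → ℝ≥0∞) :=
  (comap_measurable _).mono (le_sup_of_le_left (le_iSup₂ (f := fun s : ℝ≥0 =>
    fun _ : s ≤ t => MeasurableSpace.comap (S s : Path D → ℝ≥0∞) inferInstance) s h)) le_rfl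

/-- A set of the `σ`-algebra at time `t` is invariant under the maps which preserve `Θ` and the
paths of `S` up to time `t`. -/
theorem mem_iff_of_measurableSet_F {t : ℝ≥0} {φ : Path D → Path D} {E : Set (Path D)}
    (hΘ : ∀ ω ∈ E, Θ (φ ω) = Θ ω) (hS : ∀ ω ∈ E, ∀ s ≤ t, S s (φ ω) = S s ω) {A : Set (Path D)}
    (hA : MeasurableSet[F D t] A) : ∀ ω ∈ E, (φ ω ∈ A ↔ ω ∈ A) := by
  -- The invariant sets form a `σ`-algebra, so only the generators have to be checked.
  let m : MeasurableSpace (Path D) :=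
    { MeasurableSet' := fun A => ∀ ω ∈ E, (φ ω ∈ A ↔ ω ∈ A)
      measurableSet_empty := by simp
      measurableSet_compl := fun A h ω hω => not_congr (h ω hω)
      measurableSet_iUnion := fun f h ω hω => by
        simp only [Set.mem_iUnion]
        exact exists_congr fun i => h i ω hω }
  have hle : F D t ≤ m := by
    refine sup_le (iSup_le fun s => iSup_le fun hs => ?_) ?_
    · rintro _ ⟨B, -, rfl⟩ ω hω
      simp only [Set.mem_preimage, hS ω hω s hs]
    · rintro _ ⟨B, -, rfl⟩ ω hω
      simp only [Set.mem_preimage, hΘ ω hω]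
  exact hle A hA

/-- The path of `S` determines all interarrival times and claims. -/
theorem eq_of_S_eq {ω ω' : Path D} (h : ∀ q : ℚ, S (Real.toNNReal q) ω = S (Real.toNNReal q) ω') :
    ∀ n, W n ω = W n ω' ∧ X n ω = X n ω' := by
  have hrat : ∀ a b : ℝ, 0 ≤ a → a < b →
      ∃ q : ℚ, a ≤ (Real.toNNReal q : ℝ) ∧ (Real.toNNReal q : ℝ) < b := by
    intro a b ha hab
    obtain ⟨q, hq1, hq2⟩ := exists_rat_btwn hab
    refine ⟨q, ?_⟩
    rw [Real.coe_toNNReal _ (ha.trans hq1.le)]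
    exact ⟨hq1.le, hq2⟩
  intro n
  induction n using Nat.strong_induction_on with
  | _ n ih =>
  have hTn : T n ω = T n ω' := Finset.sum_congr rfl fun j hj => by
    rw [(ih j (Finset.mem_range.1 hj)).1]
  have hXn : ∑ k ∈ Finset.range n, ENNReal.ofReal (X k ω : ℝ) =
      ∑ k ∈ Finset.range n, ENNReal.ofReal (X k ω' : ℝ) := Finset.sum_congr rfl fun j hj => by
    rw [(ih j (Finset.mem_range.1 hj)).2]
  have hnn : ∀ m (ω : Path D), 0 ≤ T m ω := fun m ω => by
    rw [← T_zero ω]; exact (T_strictMono ω).monotone (Nat.zero_le m)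
  have hfin : ∀ m (ω : Path D), ∑ k ∈ Finset.range m, ENNReal.ofReal (X k ω : ℝ) ≠ ⊤ := fun m ω =>
    (ENNReal.sum_lt_top.2 fun _ _ => ENNReal.ofReal_lt_top).ne
  -- If arrival `n + 1` came strictly earlier on one path, a rational time in between would separate
  -- the two values of `S` by at least a positive claim.
  have key : ∀ ω ω' : Path D, (∀ q : ℚ, S (Real.toNNReal q) ω = S (Real.toNNReal q) ω') → T n ω = T n ω' →
      ∑ k ∈ Finset.range n, ENNReal.ofReal (X k ω : ℝ) =
        ∑ k ∈ Finset.range n, ENNReal.ofReal (X k ω' : ℝ) → T (n + 1) ω' ≤ T (n + 1) ω := by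
    intro ω ω' h hTn hXn
    by_contra! hlt
    obtain ⟨q, hq1, hq2⟩ := hrat _ _ (hnn _ _) hlt
    have e1 := sum_le_S (n := n + 1) hq1
    have e2 := S_eq_sum (n := n) (hTn ▸ ((T_strictMono ω).monotone n.le_succ).trans hq1) hq2
    rw [h q, e2, Finset.sum_range_succ, ← hXn] at e1
    have : 0 < ENNReal.ofReal (X n ω : ℝ) := by simpa using X_pos n ω
    exact absurd e1 (not_le.2 (ENNReal.lt_add_right (hfin _ _) this.ne'))
  have hT : T (n + 1) ω = T (n + 1) ω' :=
    le_antisymm (key ω' ω (fun q => (h q).symm) hTn.symm hXn.symm) (key ω ω' h hTn hXn)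
  refine ⟨?_, ?_⟩
  · rw [T_succ, T_succ, hTn] at hT
    exact Subtype.ext (add_left_cancel hT)
  -- At a rational time after arrival `n + 1` and before the next arrival of either path, the two
  -- sums differ at most in their last claim.
  · obtain ⟨q, hq1, hq2⟩ := hrat (T (n + 1) ω) (min (T (n + 2) ω) (T (n + 2) ω')) (hnn _ _)
      (lt_min (T_strictMono ω (Nat.lt_succ_self _)) (hT ▸ T_strictMono ω' (Nat.lt_succ_self _)))
    have e1 := S_eq_sum (n := n + 1) hq1 (hq2.trans_le (min_le_left _ _))
    have e2 := S_eq_sum (n := n + 1) (hT ▸ hq1) (hq2.trans_le (min_le_right _ _))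
    rw [h q, e2, Finset.sum_range_succ, Finset.sum_range_succ, hXn] at e1
    have := (ENNReal.add_right_inj (hfin _ _)).1 e1
    exact Subtype.ext ((ENNReal.ofReal_eq_ofReal_iff (X n ω').2.le (X n ω).2.le).1 this).symm

/-- By the Lusin–Souslin theorem, an injective measurable map on a standard Borel space is an
embedding. Only countably many times are used, so that the target is standard as well. -/
theorem measurableEmbedding_S_Θ :
    MeasurableEmbedding fun ω : Path D => ((fun q : ℚ => S (Real.toNNReal q) ω), Θ ω) := by
  -- `D` is an arbitrary subset and need not be standard Borel. The argument is therefore run on the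
  -- two sequences alone, with a one-point parameter space, and the identity of `D` is adjoined
  -- afterwards.
  let D' : Set (Fin 0 → ℝ) := Set.univ
  let θ' : D' := ⟨0, trivial⟩
  let Ψ : (ℕ → Υ) × (ℕ → Υ) → (ℚ → ℝ≥0∞) := fun y q => S (Real.toNNReal q) ((y.1, y.2, θ') : Path D')
  have hΨ : Measurable Ψ := measurable_pi_lambda _ fun q =>
    (measurable_S (D := D') (Real.toNNReal q)).comp (by fun_prop)
  have hinj : Function.Injective Ψ := fun y y' h => by
    have := eq_of_S_eq (D := D') (ω := (y.1, y.2, θ')) (ω' := (y'.1, y'.2, θ')) fun q => congrFun h q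
    exact Prod.ext (funext fun n => (this n).1) (funext fun n => (this n).2)
  have : StandardBorelSpace Υ := measurableSet_Ioi.standardBorel
  have hemb := (hΨ.measurableEmbedding hinj).prodMap
    (MeasurableEmbedding.id (α := D) (mα := inferInstance))
  exact hemb.comp (MeasurableEquiv.prodAssoc.symm : Path D ≃ᵐ _).measurableEmbedding

theorem iSup_F_eq : ⨆ t : ℝ≥0, F D t = (inferInstance : MeasurableSpace (Path D)) := by
  refine le_antisymm (iSup_le F_le) fun E hE => ?_
  have hemb := measurableEmbedding_S_Θ (D := D)
  rw [← hemb.injective.preimage_image E]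
  have hm : Measurable[⨆ t : ℝ≥0, F D t]
      fun ω : Path D => ((fun q : ℚ => S (Real.toNNReal q) ω), Θ ω) := by
    have h1 : Measurable[⨆ t : ℝ≥0, F D t]
        fun (ω : Path D) (q : ℚ) => S (Real.toNNReal q) ω := by
      refine @measurable_pi_lambda _ _ _ (⨆ t : ℝ≥0, F D t) _ _ fun q => ?_
      exact (measurable_F_S le_rfl).mono (le_iSup (F D) (Real.toNNReal q)) le_rfl
    exact h1.prodMk ((measurable_F_Θ 0).mono (le_iSup (F D) 0) le_rfl)
  exact hm (hemb.measurableSet_image' hE)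

theorem ext_of_F {Q Q' : Measure (Path D)} [IsFiniteMeasure Q]
    (h : ∀ (t : ℝ≥0) (A : Set (Path D)), MeasurableSet[F D t] A → Q A = Q' A) : Q = Q' := by
  refine ext_of_generate_finite (⋃ t : ℝ≥0, {A | MeasurableSet[F D t] A}) ?_
    (isPiSystem_iUnion_of_monotone _ (fun t => @MeasurableSpace.isPiSystem_measurableSet _ (F D t))
      fun s t hst => F_mono hst) ?_ (h 0 _ .univ)
  · exact (iSup_F_eq (D := D)).symm.trans
      (MeasurableSpace.generateFrom_iUnion_measurableSet (F D)).symm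
  · intro A hA
    obtain ⟨t, ht⟩ := Set.mem_iUnion.1 hA
    exact h t A ht

/-! ### The first claim -/

/-- At time `t` the first arrival is known only if it has occurred. For `0 ≤ a < t` the event `W 0 ≤
a` is `0 < S a`; for other `a` the preimage is everything or empty. -/
theorem measurable_F_min_W (t : ℝ≥0) :
    Measurable[F D t] fun ω : Path D => min (W 0 ω : ℝ) t := by
  refine @measurable_of_Iic ℝ (Path D) _ _ _ (F D t) _ _ _ _ fun a => ?_
  rcases le_or_gt (t : ℝ) a with hta | hta
  · convert! @MeasurableSet.univ _ (F D t)
    ext ω; simp [hta]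
  rcases lt_or_ge a 0 with ha | ha
  · convert! @MeasurableSet.empty _ (F D t)
    ext ω
    have : (0 : ℝ) < W 0 ω := (W 0 ω).2
    simp only [Set.mem_preimage, Set.mem_Iic, inf_le_iff, Set.mem_empty_iff_false, iff_false,
      not_or, not_le]
    exact ⟨ha.trans this, hta⟩
  · have := measurable_F_S (D := D) (s := a.toNNReal) (t := t)
      (by rw [Real.toNNReal_le_iff_le_coe]; exact hta.le) (measurableSet_Ioi (a := (0 : ℝ≥0∞)))
    convert! this using 1
    ext ω
    simp only [Set.mem_preimage, Set.mem_Iic, inf_le_iff, not_le.2 hta, or_false, Set.mem_Ioi,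
      S_pos_iff, Real.coe_toNNReal _ ha]

theorem measurableSet_F_Θ_W (t : ℝ≥0) {G : Set (D × Υ)} (hG : MeasurableSet G) :
    MeasurableSet[F D t] {ω : Path D | (W 0 ω : ℝ) ≤ t ∧ (Θ ω, W 0 ω) ∈ G} := by
  have hemb : MeasurableEmbedding (Prod.map id Subtype.val : D × Υ → D × ℝ) :=
    MeasurableEmbedding.id.prodMap (MeasurableEmbedding.subtype_coe measurableSet_Ioi)
  have h1 : Measurable[F D t] fun ω : Path D => (Θ ω, min (W 0 ω : ℝ) t) :=
    (measurable_F_Θ t).prodMk (measurable_F_min_W t)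
  convert! (measurable_F_S (D := D) le_rfl (measurableSet_Ioi (a := (0 : ℝ≥0∞)))).inter
    (h1 (hemb.measurableSet_image' hG)) using 1
  ext ω
  simp only [Set.mem_ofPred_eq, Set.mem_inter_iff, Set.mem_preimage, Set.mem_Ioi, S_pos_iff]
  refine and_congr_right fun h => ?_
  rw [min_eq_left h]
  exact (hemb.injective.mem_set_image (a := (Θ ω, W 0 ω))).symm

/-- The first claim size, read off the path of `S` up to time `t`. -/
noncomputable def firstJump (t : ℝ≥0) (ω : Path D) : ℝ≥0∞ :=
  ⨅ q : ℚ, if 0 < S (min (Real.toNNReal q) t) ω then S (min (Real.toNNReal q) t) ω else ⊤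

theorem measurable_F_firstJump (t : ℝ≥0) : Measurable[F D t] (firstJump t : Path D → ℝ≥0∞) := by
  refine Measurable.iInf fun q => ?_
  have := measurable_F_S (D := D) (min_le_right (Real.toNNReal q) t)
  exact Measurable.ite (this measurableSet_Ioi) this measurable_const

/-- Any positive value of `S` is at least the first claim, and the value on `[T 1, T 2)` equals it.
Capping the rational times at `t` respects the filtration and still reaches `t` itself, which is
needed when `W 0 ω = t`. -/
theorem firstJump_eq {t : ℝ≥0} {ω : Path D} (h : (W 0 ω : ℝ) ≤ t) :
    firstJump t ω = ENNReal.ofReal (X 0 ω : ℝ) := by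
  refine le_antisymm ?_ (le_iInf fun q => ?_)
  · obtain ⟨q, hq1, hq2⟩ := exists_rat_btwn (T_strictMono ω (Nat.lt_succ_self 1))
    replace hq1 : (W 0 ω : ℝ) < q := by simpa only [T_one] using hq1
    have h0 : (0 : ℝ) < W 0 ω := (W 0 ω).2
    have hc : ((min (Real.toNNReal q) t : ℝ≥0) : ℝ) = min (q : ℝ) t := by
      rw [NNReal.coe_min, Real.coe_toNNReal _ (h0.trans hq1).le]
    have h1 : T 1 ω ≤ ((min (Real.toNNReal q) t : ℝ≥0) : ℝ) := by
      rw [hc, T_one]; exact le_min hq1.le h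
    have h2 : ((min (Real.toNNReal q) t : ℝ≥0) : ℝ) < T (1 + 1) ω := by
      rw [hc]; exact (min_le_left _ _).trans_lt hq2
    refine (iInf_le _ q).trans ?_
    rw [if_pos (S_pos_iff.2 (by rwa [T_one] at h1)), S_eq_sum h1 h2]
    simp
  · split_ifs with hs
    · have := sum_le_S (n := 1) (ω := ω) (by rw [T_one]; exact S_pos_iff.1 hs)
      simpa using this
    · exact le_top

theorem measurableSet_F_X (t : ℝ≥0) {B : Set Υ} (hB : MeasurableSet B) :
    MeasurableSet[F D t] {ω : Path D | (W 0 ω : ℝ) ≤ t ∧ X 0 ω ∈ B} := by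
  have h1 : Measurable[F D t] fun ω : Path D => (firstJump t ω).toReal :=
    (measurable_F_firstJump t).ennreal_toReal
  convert! (measurable_F_S (D := D) le_rfl (measurableSet_Ioi (a := (0 : ℝ≥0∞)))).inter
    (h1 (measurableSet_Ioi.subtype_image hB)) using 1
  ext ω
  simp only [Set.mem_ofPred_eq, Set.mem_inter_iff, Set.mem_preimage, Set.mem_Ioi, S_pos_iff]
  refine and_congr_right fun h => ?_
  rw [firstJump_eq h, ENNReal.toReal_ofReal (X_pos 0 ω).le, Subtype.val_injective.mem_set_image]

/-- Null sets are preserved on each member of the filtration. -/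
def ProgAC (Q P : Measure (Path D)) : Prop :=
  ∀ (t : ℝ≥0) (A : Set (Path D)), MeasurableSet[F D t] A → P A = 0 → Q A = 0

/-- Null sets are only compared at finite times. Since `W 0` is finite, `E` is exhausted by its
parts on `{W 0 ≤ n}`, each observable at time `n`. -/
theorem ProgAC.measure_eq_zero {Q P : Measure (Path D)} (h : ProgAC Q P) {E : Set (Path D)}
    (hE : ∀ t : ℝ≥0, MeasurableSet[F D t] {ω | (W 0 ω : ℝ) ≤ t ∧ ω ∈ E}) (hP : P E = 0) :
    Q E = 0 := by
  have : E = ⋃ n : ℕ, {ω | (W 0 ω : ℝ) ≤ (n : ℝ≥0) ∧ ω ∈ E} := by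
    ext ω
    simp only [Set.mem_iUnion, Set.mem_ofPred_eq, exists_and_right]
    exact ⟨fun hω => ⟨by simpa using exists_nat_ge (W 0 ω : ℝ), hω⟩, fun hω => hω.2⟩
  rw [this, measure_iUnion_null_iff]
  exact fun n => h n _ (hE n) (measure_mono_null (fun ω hω => hω.2) hP)

theorem ProgAC.map_Θ_W {Q P : Measure (Path D)} (h : ProgAC Q P) :
    Q.map (fun ω => (Θ ω, W 0 ω)) ≪ P.map (fun ω => (Θ ω, W 0 ω)) := by
  have hm : Measurable fun ω : Path D => (Θ ω, W 0 ω) := by fun_prop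
  refine Measure.AbsolutelyContinuous.mk fun G hG h0 => ?_
  rw [Measure.map_apply hm hG] at h0 ⊢
  exact h.measure_eq_zero (fun t => measurableSet_F_Θ_W t hG) h0

theorem ProgAC.map_X {Q P : Measure (Path D)} (h : ProgAC Q P) :
    Q.map (X 0) ≪ P.map (X 0) := by
  refine Measure.AbsolutelyContinuous.mk fun B hB h0 => ?_
  rw [Measure.map_apply (measurable_X 0) hB] at h0 ⊢
  exact h.measure_eq_zero (fun t => measurableSet_F_X t hB) h0

/-! ### Renewal fibres and their mixtures -/

/-- The law of a sequence of independent variables with distribution `l`. -/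
noncomputable abbrev iid (l : Measure Υ) [IsProbabilityMeasure l] : Measure (ℕ → Υ) :=
  Measure.infinitePi fun _ => l

/-- The law of a compound renewal process with interarrival distribution `l` and claim size
distribution `μ`, the mixing parameter being frozen at `θ`. -/
noncomputable def fiber (l μ : Measure Υ) [IsProbabilityMeasure l] [IsProbabilityMeasure μ]
    (θ : D) : Measure (Path D) :=
  (iid l).prod ((iid μ).prod (Measure.dirac θ))

instance (l μ : Measure Υ) [IsProbabilityMeasure l] [IsProbabilityMeasure μ] (θ : D) :
    IsProbabilityMeasure (fiber l μ θ) := by unfold fiber; infer_instance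

/-- The law of an i.i.d. sequence as a kernel. -/
noncomputable def iidKernel (L : Kernel D Υ) [IsMarkovKernel L] : Kernel D (ℕ → Υ) :=
  ⟨fun θ => iid (L θ), measurable_infinitePi L.measurable⟩

instance (L : Kernel D Υ) [IsMarkovKernel L] : IsMarkovKernel (iidKernel L) :=
  ⟨fun θ => inferInstanceAs (IsProbabilityMeasure (iid (L θ)))⟩

/-- The fibres as a kernel. -/
noncomputable def fiberKernel (L : Kernel D Υ) [IsMarkovKernel L] (μ : Measure Υ)
    [IsProbabilityMeasure μ] : Kernel D (Path D) :=
  iidKernel L ×ₖ (Kernel.const D (iid μ) ×ₖ Kernel.id)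

instance (L : Kernel D Υ) [IsMarkovKernel L] (μ : Measure Υ) [IsProbabilityMeasure μ] :
    IsMarkovKernel (fiberKernel L μ) := by unfold fiberKernel; infer_instance

theorem fiberKernel_apply (L : Kernel D Υ) [IsMarkovKernel L] (μ : Measure Υ)
    [IsProbabilityMeasure μ] (θ : D) : fiberKernel L μ θ = fiber (L θ) μ θ := by
  rw [fiberKernel, Kernel.prod_apply, Kernel.prod_apply, Kernel.const_apply, Kernel.id_apply]
  rfl

/-- The law of a compound mixed renewal process. -/
noncomputable def model (m : Measure D) (L : Kernel D Υ) [IsMarkovKernel L] (μ : Measure Υ)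
    [IsProbabilityMeasure μ] : Measure (Path D) :=
  m.bind (fiberKernel L μ)

section Model

variable (m : Measure D) (L : Kernel D Υ) [IsMarkovKernel L]
  (l μ : Measure Υ) [IsProbabilityMeasure l] [IsProbabilityMeasure μ]

theorem lintegral_model {f : Path D → ℝ≥0∞} (hf : Measurable f) :
    ∫⁻ ω, f ω ∂model m L μ = ∫⁻ θ, ∫⁻ ω, f ω ∂fiber (L θ) μ θ ∂m := by
  rw [model, Measure.lintegral_bind (fiberKernel L μ).aemeasurable hf.aemeasurable]
  simp_rw [fiberKernel_apply]

theorem model_apply {A : Set (Path D)} (hA : MeasurableSet A) :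
    model m L μ A = ∫⁻ θ, fiber (L θ) μ θ A ∂m := by
  rw [model, Measure.bind_apply hA (fiberKernel L μ).aemeasurable]
  simp_rw [fiberKernel_apply]

instance [IsProbabilityMeasure m] : IsProbabilityMeasure (model m L μ) := by unfold model; infer_instance

theorem map_interarrivals_fiber (θ : D) : (fiber l μ θ).map (fun ω n => W n ω) = iid l := by
  have : (fun (ω : Path D) n => W n ω) = Prod.fst := rfl
  rw [this, fiber, Measure.map_fst_prod, measure_univ, one_smul]

theorem map_snd_fiber (θ : D) :
    (fiber l μ θ).map Prod.snd = (iid μ).prod (Measure.dirac θ) := by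
  rw [fiber, Measure.map_snd_prod, measure_univ, one_smul]

theorem map_claims_fiber (θ : D) : (fiber l μ θ).map (fun ω n => X n ω) = iid μ := by
  have : (fun (ω : Path D) n => X n ω) = Prod.fst ∘ Prod.snd := rfl
  rw [this, ← Measure.map_map measurable_fst measurable_snd, map_snd_fiber, Measure.map_fst_prod,
    measure_univ, one_smul]

theorem map_Θ_fiber (θ : D) : (fiber l μ θ).map Θ = Measure.dirac θ := by
  have : (Θ : Path D → D) = Prod.snd ∘ Prod.snd := rfl
  rw [this, ← Measure.map_map measurable_snd measurable_snd, map_snd_fiber, Measure.map_snd_prod,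
    measure_univ, one_smul]

theorem map_W_fiber (θ : D) (n : ℕ) : (fiber l μ θ).map (W n) = l := by
  have : (W n : Path D → Υ) = (fun w : ℕ → Υ => w n) ∘ fun ω n => W n ω := rfl
  rw [this, ← Measure.map_map (measurable_pi_apply n) (by fun_prop), map_interarrivals_fiber,
    Measure.infinitePi_map_eval]

theorem ae_Θ_eq (θ : D) : ∀ᵐ ω ∂fiber l μ θ, Θ ω = θ := by
  have : ∀ᵐ θ' ∂(fiber l μ θ).map Θ, θ' = θ := by
    rw [map_Θ_fiber]
    exact (ae_dirac_iff (measurableSet_singleton θ)).2 rfl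
  exact ae_of_ae_map measurable_Θ.aemeasurable this

/-- Under the fibre at `θ` the event `Θ ∈ B` is deterministic; conditioning on `Θ` in the mixture
thereby becomes restriction of `m`. -/
theorem fiber_inter_Θ (θ : D) (E : Set (Path D)) (B : Set D) :
    fiber l μ θ (E ∩ Θ ⁻¹' B) = B.indicator (fun θ => fiber l μ θ E) θ := by
  by_cases h : θ ∈ B
  · rw [Set.indicator_of_mem h]
    refine measure_congr ?_
    filter_upwards [ae_Θ_eq l μ θ] with ω hω
    refine propext ⟨fun h => h.1, fun hE => ⟨hE, ?_⟩⟩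
    change Θ ω ∈ B
    rwa [hω]
  · rw [Set.indicator_of_notMem h]
    refine measure_eq_zero_iff_ae_notMem.2 ?_
    filter_upwards [ae_Θ_eq l μ θ] with ω hω hc
    exact h (hω ▸ hc.2)

theorem model_inter_Θ {E : Set (Path D)} (hE : MeasurableSet E) {B : Set D}
    (hB : MeasurableSet B) :
    model m L μ (E ∩ Θ ⁻¹' B) = ∫⁻ θ in B, fiber (L θ) μ θ E ∂m := by
  rw [model_apply m L μ (hE.inter (measurable_Θ hB)), ← lintegral_indicator hB]
  refine lintegral_congr fun θ => ?_
  rw [fiber_inter_Θ]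
  rfl

theorem map_Θ_model : (model m L μ).map Θ = m := by
  ext B hB
  rw [Measure.map_apply measurable_Θ hB]
  have := model_inter_Θ m L μ .univ hB
  simpa using this

variable [IsProbabilityMeasure m]

theorem map_Θ_W_model : (model m L μ).map (fun ω => (Θ ω, W 0 ω)) = m ⊗ₘ L := by
  ext G hG
  have hm : Measurable fun ω : Path D => (Θ ω, W 0 ω) := by fun_prop
  rw [Measure.map_apply hm hG, model_apply m L μ (hm hG), Measure.compProd_apply hG]
  refine lintegral_congr fun θ => ?_
  conv_rhs => rw [← map_W_fiber (L θ) μ θ 0]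
  rw [Measure.map_apply (measurable_W 0) (measurable_prodMk_left hG)]
  refine measure_congr ?_
  filter_upwards [ae_Θ_eq (L θ) μ θ] with ω hω
  change ((Θ ω, W 0 ω) ∈ G) = ((θ, W 0 ω) ∈ G)
  rw [hω]

theorem map_claims_model : (model m L μ).map (fun ω n => X n ω) = iid μ := by
  ext B hB
  have hm : Measurable fun (ω : Path D) n => X n ω := by fun_prop
  rw [Measure.map_apply hm hB, model_apply m L μ (hm hB)]
  have : ∀ θ : D, fiber (L θ) μ θ ((fun ω n => X n ω) ⁻¹' B) = iid μ B := fun θ => by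
    rw [← Measure.map_apply hm hB, map_claims_fiber]
  simp [this]

theorem map_X_model (n : ℕ) : (model m L μ).map (X n) = μ := by
  have : (X n : Path D → Υ) = (fun w : ℕ → Υ => w n) ∘ fun ω n => X n ω := rfl
  rw [this, ← Measure.map_map (measurable_pi_apply n) (by fun_prop), map_claims_model,
    Measure.infinitePi_map_eval]

theorem isConsistentRCP_model : IsConsistentRCP (model m L μ) fun θ => fiber (L θ) μ θ where
  prob _ := inferInstance
  meas E hE := by
    simp_rw [← fiberKernel_apply]
    exact (fiberKernel L μ).measurable_coe hE
  disint E hE := by rw [map_Θ_model, model_apply m L μ hE]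
  consistent B hB := by
    refine .of_forall fun θ hθ => ?_
    have := fiber_inter_Θ (L θ) μ θ Set.univ B
    rwa [Set.univ_inter, Set.indicator_of_mem hθ, measure_univ] at this

end Model

/-- Consistent regular conditional probabilities are essentially unique. -/
theorem IsConsistentRCP.ae_eq {Q : Measure (Path D)} [IsProbabilityMeasure Q]
    {q q' : D → Measure (Path D)} (hq : IsConsistentRCP Q q) (hq' : IsConsistentRCP Q q') :
    ∀ᵐ θ ∂(Q.map Θ), q θ = q' θ := by
  -- Consistency localizes the disintegration to `Θ ∈ B`. The joint laws of the parameter and the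
  -- path then agree on rectangles, and uniqueness of kernels gives one exceptional null set for all
  -- events.
  have key : ∀ {q : D → Measure (Path D)}, IsConsistentRCP Q q → ∀ {E : Set (Path D)} {B : Set D},
      MeasurableSet E → MeasurableSet B → ∫⁻ θ in B, q θ E ∂Q.map Θ = Q (E ∩ Θ ⁻¹' B) := by
    intro q hq E B hE hB
    rw [← hq.disint _ (hE.inter (measurable_Θ hB)), ← lintegral_indicator hB]
    refine lintegral_congr_ae ?_
    filter_upwards [hq.consistent B hB, hq.consistent Bᶜ hB.compl] with θ h1 h2
    have := hq.prob θ
    by_cases h : θ ∈ B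
    · rw [Set.indicator_of_mem h]
      have h0 : q θ (Θ ⁻¹' B)ᶜ = 0 := (prob_compl_eq_zero_iff (measurable_Θ hB)).2 (h1 h)
      exact (measure_inter_conull h0).symm
    · rw [Set.indicator_of_notMem h]
      have h0 : q θ (Θ ⁻¹' B) = 0 := by
        rw [← prob_compl_eq_one_iff (measurable_Θ hB)]; exact h2 h
      exact (measure_mono_null Set.inter_subset_right h0).symm
  have : IsProbabilityMeasure (Q.map Θ) :=
    Measure.isProbabilityMeasure_map measurable_Θ.aemeasurable
  let κ : Kernel D (Path D) := ⟨q, Measure.measurable_of_measurable_coe _ hq.meas⟩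
  let κ' : Kernel D (Path D) := ⟨q', Measure.measurable_of_measurable_coe _ hq'.meas⟩
  have : IsMarkovKernel κ := ⟨hq.prob⟩
  have : IsMarkovKernel κ' := ⟨hq'.prob⟩
  refine Kernel.ae_eq_of_compProd_eq (κ := κ) (η := κ') ?_
  refine ext_of_generate_finite _ generateFrom_prod.symm isPiSystem_prod ?_ (by simp)
  rintro _ ⟨B, hB : MeasurableSet B, E, hE : MeasurableSet E, rfl⟩
  change (Q.map Θ ⊗ₘ κ) (B ×ˢ E) = (Q.map Θ ⊗ₘ κ') (B ×ˢ E)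
  rw [Measure.compProd_apply_prod hB hE, Measure.compProd_apply_prod hB hE]
  exact (key hq hE hB).trans (key hq' hE hB).symm

/-! ### Characterization of compound mixed renewal processes -/

theorem exists_N_eq (t : ℝ≥0) :
    ∃ f : (ℕ → Υ) → ℕ∞, Measurable f ∧ ∀ ω : Path D, N t ω = f fun n => W n ω := by
  let D' : Set (Fin 0 → ℝ) := Set.univ
  let θ' : D' := ⟨0, trivial⟩
  -- Neither claims nor parameter enter `N`, so both slots may be filled with dummies.
  refine ⟨fun w => N t ((w, w, θ') : Path D'), ?_, fun ω => rfl⟩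
  refine measurable_to_countable' fun n => ?_
  have hm : Measurable fun w : ℕ → Υ => ((w, w, θ') : Path D') := by fun_prop
  exact hm (measurableSet_N_eq t n)

theorem measurable_N (t : ℝ≥0) : Measurable (N t : Path D → ℕ∞) :=
  measurable_to_countable' fun n => measurableSet_N_eq t n

theorem indepFun_N_X {P : Measure (Path D)}
    (h : IndepFun (fun (ω : Path D) n => W n ω) (fun ω n => X n ω) P) :
    IndepFun (fun (ω : Path D) (t : ℝ≥0) => N t ω) (fun ω n => X n ω) P := by
  choose f hf hN using exists_N_eq (D := D)
  have : (fun (ω : Path D) (t : ℝ≥0) => N t ω) = (fun w t => f t w) ∘ fun ω n => W n ω := by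
    ext ω t; exact hN t ω
  rw [this]
  exact h.comp (measurable_pi_lambda _ hf) measurable_id

theorem isRiskProcess_of_map_eq {P : Measure (Path D)} [IsProbabilityMeasure P] {μ : Measure Υ}
    [IsProbabilityMeasure μ] (hX : P.map (fun ω n => X n ω) = iid μ)
    (h : IndepFun (fun (ω : Path D) n => W n ω) (fun ω n => X n ω) P) : IsRiskProcess P := by
  have hXn : ∀ n, P.map (X n) = μ := fun n => by
    have : (X n : Path D → Υ) = (fun w : ℕ → Υ => w n) ∘ fun ω n => X n ω := rfl
    rw [this, ← Measure.map_map (measurable_pi_apply n) (by fun_prop), hX,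
      Measure.infinitePi_map_eval]
  refine ⟨?_, fun n => ⟨by fun_prop, by fun_prop, by rw [hXn, hXn]⟩, indepFun_N_X h⟩
  rw [iIndepFun_iff_map_fun_eq_infinitePi_map fun n => measurable_X n, hX]
  simp only [iid, hXn]

section Model

variable (m : Measure D) [IsProbabilityMeasure m] (L : Kernel D Υ) [IsMarkovKernel L]
  (l μ : Measure Υ) [IsProbabilityMeasure l] [IsProbabilityMeasure μ]

theorem isCRP_fiber (θ : D) : IsCRP (fiber l μ θ) l := by
  refine ⟨isRiskProcess_of_map_eq (map_claims_fiber l μ θ) ?_, ?_, map_W_fiber l μ θ⟩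
  · have h : IndepFun Prod.fst Prod.snd (fiber l μ θ) :=
      indepFun_prod measurable_id measurable_id
    exact h.comp measurable_id measurable_fst
  · rw [iIndepFun_iff_map_fun_eq_infinitePi_map fun n => measurable_W n, map_interarrivals_fiber]
    simp only [iid, map_W_fiber]

theorem condProb_model {A : Set (Path D)} (hA : MeasurableSet A) :
    condProb (model m L μ) A =ᵐ[model m L μ] fun ω => (fiber (L (Θ ω)) μ (Θ ω)).real A := by
  have hmeas : Measurable fun θ => (fiber (L θ) μ θ).real A := by
    simp_rw [← fiberKernel_apply]
    exact ((fiberKernel L μ).measurable_coe hA).ennreal_toReal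
  have hint : Integrable (fun ω : Path D => (fiber (L (Θ ω)) μ (Θ ω)).real A) (model m L μ) := by
    refine Integrable.of_bound (hmeas.comp measurable_Θ).aestronglyMeasurable 1
      (.of_forall fun ω => ?_)
    rw [Real.norm_of_nonneg measureReal_nonneg]
    exact measureReal_le_one
  refine (ae_eq_condExp_of_forall_setIntegral_eq sigmaTheta_le
    ((integrable_const (1 : ℝ)).indicator hA) (fun s _ _ => hint.integrableOn) ?_ ?_).symm
  · rintro _ ⟨B, hB, rfl⟩ -
    rw [setIntegral_indicator hA, setIntegral_const, smul_eq_mul, mul_one, Set.inter_comm,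
      measureReal_def, model_inter_Θ m L μ hA hB,
      integral_eq_lintegral_of_nonneg_ae (.of_forall fun _ => measureReal_nonneg)
        (hmeas.comp measurable_Θ).aestronglyMeasurable]
    congr 1
    have h1 : Measurable fun θ => fiber (L θ) μ θ A := by
      simp_rw [← fiberKernel_apply]
      exact (fiberKernel L μ).measurable_coe hA
    conv_rhs => rw [← map_Θ_model m L μ]
    rw [setLIntegral_map hB h1 measurable_Θ]
    simp
  · exact (hmeas.comp (comap_measurable Θ)).stronglyMeasurable.aestronglyMeasurable

theorem measure_box_fiber (θ : D) (n : ℕ) (B : ℕ → Set Υ) (hB : ∀ k, MeasurableSet (B k)) :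
    (fiber l μ θ).real {ω | ∀ k < n, W k ω ∈ B k} = ∏ k ∈ Finset.range n, l.real (B k) := by
  have hm : MeasurableSet (Set.pi (Finset.range n : Set ℕ) B) :=
    .pi (Finset.range n).countable_toSet fun k _ => hB k
  have : {ω : Path D | ∀ k < n, W k ω ∈ B k} =
      (fun ω n => W n ω) ⁻¹' (Set.pi (Finset.range n : Set ℕ) B) := by
    ext ω; simp
  simp only [measureReal_def]
  rw [this, ← Measure.map_apply (by fun_prop) hm, map_interarrivals_fiber,
    Measure.infinitePi_pi _ fun k _ => hB k, ENNReal.toReal_prod]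

theorem measureReal_W_fiber (θ : D) (n : ℕ) {B : Set Υ} (hB : MeasurableSet B) :
    (fiber l μ θ).real {ω | W n ω ∈ B} = l.real B := by
  conv_rhs => rw [← map_W_fiber l μ θ n]
  rw [map_measureReal_apply (measurable_W n) hB]
  rfl

theorem fiber_real_inter (θ : D) (A B : Set (ℕ → Υ)) :
    (fiber l μ θ).real {ω | (fun n => W n ω) ∈ A ∧ (fun n => X n ω) ∈ B} =
      (iid l).real A * (iid μ).real B := by
  have : {ω : Path D | (fun n => W n ω) ∈ A ∧ (fun n => X n ω) ∈ B} =
      A ×ˢ (B ×ˢ Set.univ) := by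
    ext ω; simp only [Set.mem_prod, Set.mem_univ, and_true]; rfl
  simp only [measureReal_def]
  rw [this, fiber, Measure.prod_prod, Measure.prod_prod, measure_univ, mul_one, ENNReal.toReal_mul]

theorem condIndepWX_model : CondIndepWX (model m L μ) := by
  intro A B hA hB
  have hW : Measurable fun (ω : Path D) n => W n ω := by fun_prop
  have hX : Measurable fun (ω : Path D) n => X n ω := by fun_prop
  filter_upwards [condProb_model m L μ ((hW hA).inter (hX hB)), condProb_model m L μ (hW hA),
    condProb_model m L μ (hX hB)] with ω h1 h2 h3
  have e2 := fiber_real_inter (L (Θ ω)) μ (Θ ω) A Set.univ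
  have e3 := fiber_real_inter (L (Θ ω)) μ (Θ ω) Set.univ B
  simp only [Set.mem_univ, and_true, true_and, probReal_univ, mul_one, one_mul] at e2 e3
  refine h1.trans ?_
  refine (fiber_real_inter (L (Θ ω)) μ (Θ ω) A B).trans ?_
  rw [← e2, ← e3]
  exact (congrArg₂ (· * ·) h2 h3).symm

/-- The claim law is the same in every fibre, so the independence inside the fibres survives mixing.
-/
theorem indep_model : IndepFun (fun ω : Path D => (Θ ω, fun n => W n ω)) (fun ω n => X n ω)
    (model m L μ) := by
  rw [indepFun_iff_measure_inter_preimage_eq_mul]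
  intro G B hG hB
  have hm : Measurable fun ω : Path D => (Θ ω, fun n => W n ω) := by fun_prop
  have hX : Measurable fun (ω : Path D) n => X n ω := by fun_prop
  rw [model_apply m L μ ((hm hG).inter (hX hB)), model_apply m L μ (hm hG),
    ← Measure.map_apply hX hB, map_claims_model, ← lintegral_mul_const'' _ ?_]
  · refine lintegral_congr fun θ => ?_
    have h : IndepFun Prod.fst Prod.snd (fiber (L θ) μ θ) :=
      indepFun_prod measurable_id measurable_id
    have h := (h.comp (φ := fun w : ℕ → Υ => (θ, w)) (by fun_prop) measurable_fst)
    rw [indepFun_iff_measure_inter_preimage_eq_mul] at h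
    have h := h G B hG hB
    have e1 : fiber (L θ) μ θ ((Prod.fst ∘ Prod.snd) ⁻¹' B) = iid μ B := by
      rw [← map_claims_fiber (L θ) μ θ, Measure.map_apply hX hB]; rfl
    rw [e1] at h
    have e2 : ((fun ω : Path D => (Θ ω, fun n => W n ω)) ⁻¹' G : Set (Path D))
        =ᵐ[fiber (L θ) μ θ] ((fun w : ℕ → Υ => (θ, w)) ∘ Prod.fst) ⁻¹' G := by
      filter_upwards [ae_Θ_eq (L θ) μ θ] with ω hω
      change ((Θ ω, fun n => W n ω) ∈ G) = ((θ, fun n => W n ω) ∈ G)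
      rw [hω]
    rw [measure_congr e2, ← h]
    exact measure_congr (e2.inter (ae_eq_refl _))
  · simp_rw [← fiberKernel_apply]
    exact ((fiberKernel L μ).measurable_coe (hm hG)).aemeasurable

theorem indepThetaX_model : IndepThetaX (model m L μ) :=
  (indep_model m L μ).comp measurable_fst measurable_id

theorem isCMRP_model : IsCMRP (model m L μ) fun θ => L θ where
  risk := isRiskProcess_of_map_eq (map_claims_model m L μ)
    ((indep_model m L μ).comp measurable_snd measurable_id)
  mrp :=
    { condIndep := by
        intro n v
        have hB : ∀ k, MeasurableSet {w : Υ | (w : ℝ) ≤ v k} := fun k =>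
          measurableSet_le measurable_subtype_coe measurable_const
        have hA : MeasurableSet {ω : Path D | ∀ k < n, (W k ω : ℝ) ≤ v k} := by
          simp_rw [Set.ofPred_forall]
          exact .iInter fun k => .iInter fun _ => measurable_W k (hB k)
        have h2 : ∀ᵐ ω ∂model m L μ, ∀ k, condProb (model m L μ) {ω' | (W k ω' : ℝ) ≤ v k} ω =
            (fiber (L (Θ ω)) μ (Θ ω)).real {ω' | (W k ω' : ℝ) ≤ v k} :=
          ae_all_iff.2 fun k => condProb_model m L μ (measurable_W k (hB k))
        filter_upwards [condProb_model m L μ hA, h2] with ω h1 h2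
        rw [h1]
        refine (measure_box_fiber (L (Θ ω)) μ (Θ ω) n _ hB).trans ?_
        refine Finset.prod_congr rfl fun k _ => ?_
        rw [h2 k]
        exact (measureReal_W_fiber (L (Θ ω)) μ (Θ ω) k (hB k)).symm
      condDistrib := by
        intro n B hB
        filter_upwards [condProb_model m L μ (measurable_W n hB)] with ω h1
        exact h1.trans (measureReal_W_fiber (L (Θ ω)) μ (Θ ω) n hB) }

end Model

/-- The boxes `{w | w k ≤ v k for all k < n}`. -/
def lowerBoxes : Set (Set (ℕ → Υ)) :=
  {s | ∃ (n : ℕ) (v : ℕ → ℝ), s = {w | ∀ k < n, (w k : ℝ) ≤ v k}}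

theorem isPiSystem_lowerBoxes : IsPiSystem lowerBoxes := by
  have key : ∀ (n n' : ℕ) (v v' : ℕ → ℝ), n ≤ n' →
      {w : ℕ → Υ | ∀ k < n, (w k : ℝ) ≤ v k} ∩ {w | ∀ k < n', (w k : ℝ) ≤ v' k} ∈ lowerBoxes := by
    intro n n' v v' h
    refine ⟨n', fun k => if k < n then min (v k) (v' k) else v' k, ?_⟩
    ext w
    simp only [Set.mem_inter_iff, Set.mem_ofPred_eq]
    refine ⟨fun hw k hk => ?_, fun hw => ⟨fun k hk => ?_, fun k hk => ?_⟩⟩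
    · split_ifs with hkn
      · exact le_min (hw.1 k hkn) (hw.2 k hk)
      · exact hw.2 k hk
    · have := hw k (hk.trans_le h)
      rw [if_pos hk] at this
      exact this.trans (min_le_left _ _)
    · have := hw k hk
      split_ifs at this
      · exact this.trans (min_le_right _ _)
      · exact this
  rintro _ ⟨n, v, rfl⟩ _ ⟨n', v', rfl⟩ -
  rcases le_total n n' with h | h
  · exact key n n' v v' h
  · rw [Set.inter_comm]; exact key n' n v' v h

theorem generateFrom_lowerBoxes :
    MeasurableSpace.generateFrom lowerBoxes = (inferInstance : MeasurableSpace (ℕ → Υ)) := by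
  refine le_antisymm (MeasurableSpace.generateFrom_le ?_) (iSup_le fun j => ?_)
  · rintro _ ⟨n, v, rfl⟩
    simp_rw [Set.ofPred_forall]
    exact .iInter fun k => .iInter fun _ => measurableSet_le (by fun_prop) measurable_const
  · refine Measurable.comap_le (m₁ := MeasurableSpace.generateFrom lowerBoxes) ?_
    have : @Measurable _ _ (MeasurableSpace.generateFrom lowerBoxes) _
        fun w : ℕ → Υ => (w j : ℝ) := by
      refine @measurable_of_Iic ℝ (ℕ → Υ) _ _ _ (_) _ _ _ _ fun a => ?_
      -- A half-line in coordinate `j` is a union of boxes whose other sides grow; the sum of the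
      -- positive coordinates up to `j` bounds each of them.
      have : (fun w : ℕ → Υ => (w j : ℝ)) ⁻¹' Set.Iic a =
          ⋃ M : ℕ, {w | ∀ k < j + 1, (w k : ℝ) ≤ if k = j then a else M} := by
        ext w
        simp only [Set.mem_preimage, Set.mem_Iic, Set.mem_iUnion, Set.mem_ofPred_eq]
        constructor
        · intro h
          obtain ⟨M, hM⟩ := exists_nat_ge (∑ k ∈ Finset.range (j + 1), (w k : ℝ))
          refine ⟨M, fun k hk => ?_⟩
          split_ifs with hkj
          · rwa [hkj]
          · exact (Finset.single_le_sum (f := fun k => (w k : ℝ)) (fun i _ => (w i).2.le)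
              (Finset.mem_range.2 hk)).trans hM
        · rintro ⟨M, hM⟩
          simpa using hM j (Nat.lt_succ_self j)
      rw [this]
      exact .iUnion fun M => MeasurableSpace.measurableSet_generateFrom ⟨_, _, rfl⟩
    exact this.subtype_mk

theorem IsRiskProcess.map_claims {Q : Measure (Path D)} (h : IsRiskProcess Q)
    [IsProbabilityMeasure (Q.map (X 0))] :
    Q.map (fun ω n => X n ω) = iid (Q.map (X 0)) := by
  have := h.indep_claims.isProbabilityMeasure
  rw [(iIndepFun_iff_map_fun_eq_infinitePi_map fun n => measurable_X n).1 h.indep_claims]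
  simp only [iid, fun n => (h.ident_claims n).map_eq]

/-- The finite dimensional distributions of a compound mixed renewal process. -/
theorem IsCMRP.measureReal_box {Q : Measure (Path D)} [IsProbabilityMeasure Q]
    {L : Kernel D Υ} (a1 : CondIndepWX Q) (a2 : IndepThetaX Q)
    (h : IsCMRP Q fun θ => L θ) (n : ℕ) (v : ℕ → ℝ) {B : Set (ℕ → Υ)} (hB : MeasurableSet B)
    {C : Set D} (hC : MeasurableSet C) :
    Q.real ({ω | (∀ k < n, (W k ω : ℝ) ≤ v k) ∧ (fun n => X n ω) ∈ B} ∩ Θ ⁻¹' C) =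
      (∫ θ in C, ∏ k ∈ Finset.range n, (L θ).real {w | (w : ℝ) ≤ v k} ∂Q.map Θ) *
        (Q.map fun ω n => X n ω).real B := by
  have hI : ∀ k, MeasurableSet {w : Υ | (w : ℝ) ≤ v k} := fun k =>
    measurableSet_le measurable_subtype_coe measurable_const
  have hbox : MeasurableSet {w : ℕ → Υ | ∀ k < n, (w k : ℝ) ≤ v k} := by
    simp_rw [Set.ofPred_forall]
    exact .iInter fun k => .iInter fun _ => measurableSet_le (by fun_prop) measurable_const
  have hW : Measurable fun (ω : Path D) n => W n ω := by fun_prop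
  have hX : Measurable fun (ω : Path D) n => X n ω := by fun_prop
  have hA : MeasurableSet {ω : Path D | (∀ k < n, (W k ω : ℝ) ≤ v k) ∧ (fun n => X n ω) ∈ B} :=
    (hW hbox).inter (hX hB)
  have hΘC : MeasurableSet[sigmaTheta D] (Θ ⁻¹' C) := ⟨C, hC, rfl⟩
  have e1 : Q.real ({ω | (∀ k < n, (W k ω : ℝ) ≤ v k) ∧ (fun n => X n ω) ∈ B} ∩ Θ ⁻¹' C) =
      ∫ ω in Θ ⁻¹' C, condProb Q
        {ω | (∀ k < n, (W k ω : ℝ) ≤ v k) ∧ (fun n => X n ω) ∈ B} ω ∂Q := by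
    rw [condProb, setIntegral_condExp sigmaTheta_le ((integrable_const (1 : ℝ)).indicator hA) hΘC,
      setIntegral_indicator hA, setIntegral_const, smul_eq_mul, mul_one, Set.inter_comm]
  -- By (a2), conditioning the claims on `Θ` has no effect.
  have e2 : condProb Q {ω | (fun n => X n ω) ∈ B} =ᵐ[Q] fun _ =>
      (Q.map fun ω n => X n ω).real B := by
    have hind := condExp_indep_eq (m₁ := MeasurableSpace.comap (fun (ω : Path D) n => X n ω)
      inferInstance) (m₂ := sigmaTheta D) (μ := Q) hX.comap_le sigmaTheta_le
      (f := {ω : Path D | (fun n => X n ω) ∈ B}.indicator fun _ => (1 : ℝ))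
      (stronglyMeasurable_const.indicator ⟨B, hB, rfl⟩) a2.symm
    refine hind.trans (.of_forall fun ω => ?_)
    refine (integral_indicator_const (1 : ℝ) (hX hB)).trans ?_
    rw [smul_eq_mul, mul_one, map_measureReal_apply hX hB]
  have e3 : ∀ᵐ ω ∂Q, ∀ k, condProb Q {ω' | (W k ω' : ℝ) ≤ v k} ω =
      (L (Θ ω)).real {w : Υ | (w : ℝ) ≤ v k} :=
    ae_all_iff.2 fun k => h.mrp.condDistrib k _ (hI k)
  have e4 : condProb Q {ω | (∀ k < n, (W k ω : ℝ) ≤ v k) ∧ (fun n => X n ω) ∈ B} =ᵐ[Q] fun ω =>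
      (∏ k ∈ Finset.range n, (L (Θ ω)).real {w : Υ | (w : ℝ) ≤ v k}) *
        (Q.map fun ω n => X n ω).real B := by
    filter_upwards [a1 _ B hbox hB, e2, e3, h.mrp.condIndep n v] with ω h1 h2 h3 h4
    refine h1.trans ?_
    rw [h2]
    refine congrArg (· * _) (h4.trans ?_)
    exact Finset.prod_congr rfl fun k _ => h3 k
  rw [e1, integral_congr_ae (ae_restrict_of_ae e4), integral_mul_const]
  congr 1
  refine (setIntegral_map (f := fun θ => ∏ k ∈ Finset.range n, (L θ).real {w | (w : ℝ) ≤ v k})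
    hC ?_ measurable_Θ.aemeasurable).symm
  exact (Finset.measurable_prod _ fun k _ =>
    (L.measurable_coe (hI k)).ennreal_toReal).aestronglyMeasurable

/-- A compound mixed renewal process with the properties (a1) and (a2) is determined by the law of
its mixing parameter and the distributions of the interarrival times and of the claims. -/
theorem IsCMRP.eq_model {Q : Measure (Path D)} [IsProbabilityMeasure Q]
    {L : Kernel D Υ} [IsMarkovKernel L] (a1 : CondIndepWX Q) (a2 : IndepThetaX Q)
    (h : IsCMRP Q fun θ => L θ) {m : Measure D} {μ : Measure Υ} [IsProbabilityMeasure m]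
    [IsProbabilityMeasure μ] (hm : Q.map Θ = m) (hμ : Q.map (X 0) = μ) : Q = model m L μ := by
  subst hm hμ
  set R := model (Q.map Θ) L (Q.map (X 0)) with hR
  have hW : Measurable fun (ω : Path D) n => W n ω := by fun_prop
  have hX : Measurable fun (ω : Path D) n => X n ω := by fun_prop
  refine Measure.ext_prod₃ fun {A B C} hA hB hC => ?_
  set G : Set (Path D) := (fun ω n => X n ω) ⁻¹' B ∩ Θ ⁻¹' C
  have hG : MeasurableSet G := (hX hB).inter (measurable_Θ hC)
  -- With the claim and parameter events fixed, only the interarrival sequence varies. Conditional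
  -- independence is given on lower boxes, and these form a generating `π`-system; `R` satisfies the
  -- same hypotheses as `Q`, so one formula evaluates both.
  have key : (Q.restrict G).map (fun ω n => W n ω) = (R.restrict G).map fun ω n => W n ω := by
    have hbox : ∀ s ∈ lowerBoxes, (Q.restrict G).map (fun ω n => W n ω) s =
        (R.restrict G).map (fun ω n => W n ω) s := by
      intro s hs
      have hsm : MeasurableSet s := by
        exact generateFrom_lowerBoxes.le s (MeasurableSpace.measurableSet_generateFrom hs)
      obtain ⟨n, v, rfl⟩ := hs
      rw [Measure.map_apply hW hsm, Measure.map_apply hW hsm, Measure.restrict_apply (hW hsm),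
        Measure.restrict_apply (hW hsm), ← measureReal_eq_measureReal_iff]
      have hset : (fun (ω : Path D) n => W n ω) ⁻¹' {w | ∀ k < n, (w k : ℝ) ≤ v k} ∩ G =
          {ω | (∀ k < n, (W k ω : ℝ) ≤ v k) ∧ (fun n => X n ω) ∈ B} ∩ Θ ⁻¹' C := by
        ext ω; simp only [G, Set.mem_inter_iff, Set.mem_preimage, Set.mem_ofPred_eq, and_assoc]
      rw [hset, h.measureReal_box a1 a2 n v hB hC, (isCMRP_model _ L _).measureReal_box
        (condIndepWX_model _ _ _) (indepThetaX_model _ _ _) n v hB hC, map_Θ_model,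
        map_claims_model, h.risk.map_claims]
    refine ext_of_generate_finite _ generateFrom_lowerBoxes.symm isPiSystem_lowerBoxes hbox ?_
    -- The box with no constraints is the whole space, which gives equality of total masses.
    exact hbox _ ⟨0, 0, by simp⟩
  have := congrArg (fun ν => ν A) key
  rwa [Measure.map_apply hW hA, Measure.map_apply hW hA, Measure.restrict_apply (hW hA),
    Measure.restrict_apply (hW hA)] at this

/-! ### Change of measure on the fibres -/

/-- A function of a path that only depends on the first `n` interarrival times and claims. -/
def DependsOnFirst (n : ℕ) (f : Path D → ℝ≥0∞) : Prop :=
  ∀ ω ω' : Path D, (∀ k < n, W k ω = W k ω') → (∀ k < n, X k ω = X k ω') → Θ ω = Θ ω' → f ω = f ω'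

theorem DependsOnFirst.mul {n : ℕ} {f g : Path D → ℝ≥0∞} (hf : DependsOnFirst n f)
    (hg : DependsOnFirst n g) : DependsOnFirst n fun ω => f ω * g ω :=
  fun ω ω' h1 h2 h3 => congrArg₂ _ (hf ω ω' h1 h2 h3) (hg ω ω' h1 h2 h3)

theorem T_congr {n : ℕ} {ω ω' : Path D} (h : ∀ k < n, W k ω = W k ω') : T n ω = T n ω' :=
  Finset.sum_congr rfl fun j hj => by rw [h j (Finset.mem_range.1 hj)]

theorem dependsOnFirst_T (n : ℕ) (f : ℝ → ℝ≥0∞) :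
    DependsOnFirst n fun ω : Path D => f (T n ω) :=
  fun _ _ h1 _ _ => congrArg f (T_congr h1)

section Fiber

variable (l l' μ μ' : Measure Υ) [IsProbabilityMeasure l] [IsProbabilityMeasure l']
  [IsProbabilityMeasure μ] [IsProbabilityMeasure μ'] (θ : D)

/-- Full i.i.d. sequences of different laws have no density with respect to each other. As `f`
ignores the coordinates from `n` on, `l'` may first be replaced by `l` there, leaving finitely many
changed factors. -/
theorem lintegral_iid_withDensity {g : Υ → ℝ≥0∞} (hg : Measurable g) (h : l' = l.withDensity g)
    (n : ℕ) {f : (ℕ → Υ) → ℝ≥0∞} (hf : Measurable f)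
    (hfn : ∀ w w' : ℕ → Υ, (∀ i < n, w i = w' i) → f w = f w') :
    ∫⁻ w, f w ∂iid l' = ∫⁻ w, f w * ∏ j ∈ Finset.range n, g (w j) ∂iid l := by
  have hprob : ∀ i, IsProbabilityMeasure (if i < n then l' else l) := fun i => by
    split_ifs <;> infer_instance
  rw [lintegral_infinitePi_congr (fun _ => l') (fun i => if i < n then l' else l) (Finset.range n)
    (fun i hi => by rw [if_pos (Finset.mem_range.1 hi)]) hf
    fun w w' hw => hfn w w' fun i hi => hw i (Finset.mem_range.2 hi),
    infinitePi_eq_withDensity (fun _ => l) (fun i => if i < n then l' else l) (Finset.range n)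
      (g := fun _ => g) (fun _ => hg) (fun i hi => by rw [if_pos (Finset.mem_range.1 hi), h])
      (fun i hi => by rw [if_neg (by simpa using hi)]),
    lintegral_withDensity_eq_lintegral_mul _ (by fun_prop) hf]
  simp only [Pi.mul_apply, mul_comm]

theorem lintegral_fiber {f : Path D → ℝ≥0∞} (hf : Measurable f) :
    ∫⁻ ω, f ω ∂fiber l μ θ = ∫⁻ x, ∫⁻ w, f (w, x, θ) ∂iid l ∂iid μ := by
  rw [fiber, lintegral_prod_symm _ hf.aemeasurable, lintegral_prod _ ?_]
  · refine lintegral_congr fun x => ?_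
    refine lintegral_dirac' θ ?_
    exact Measurable.lintegral_prod_right' (f := fun q : D × (ℕ → Υ) => f (q.2, x, q.1))
      (by fun_prop)
  · exact (Measurable.lintegral_prod_left' hf).aemeasurable

theorem lintegral_fiber' {f : Path D → ℝ≥0∞} (hf : Measurable f) :
    ∫⁻ ω, f ω ∂fiber l μ θ = ∫⁻ w, ∫⁻ x, f (w, x, θ) ∂iid μ ∂iid l := by
  rw [lintegral_fiber l μ θ hf]
  refine lintegral_lintegral_swap ?_
  exact Measurable.aemeasurable
    (f := fun q : (ℕ → Υ) × (ℕ → Υ) => f (q.2, q.1, θ)) (by fun_prop)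

/-- Changing the distributions of finitely many interarrival times and claims. -/
theorem lintegral_fiber_withDensity {g k : Υ → ℝ≥0∞} (hg : Measurable g) (hk : Measurable k)
    (hl : l' = l.withDensity g) (hμ : μ' = μ.withDensity k) (n : ℕ) {f : Path D → ℝ≥0∞}
    (hf : Measurable f) (hfn : DependsOnFirst n f) :
    ∫⁻ ω, f ω ∂fiber l' μ' θ =
      ∫⁻ ω, f ω * ∏ j ∈ Finset.range n, k (X j ω) * g (W j ω) ∂fiber l μ θ := by
  have h1 : ∫⁻ ω, f ω ∂fiber l' μ' θ =
      ∫⁻ ω, f ω * ∏ j ∈ Finset.range n, g (W j ω) ∂fiber l μ' θ := by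
    rw [lintegral_fiber _ _ _ hf, lintegral_fiber _ _ _ (by fun_prop)]
    refine lintegral_congr fun x => ?_
    exact lintegral_iid_withDensity l l' hg hl n (by fun_prop) fun w w' hw =>
      hfn _ _ hw (fun _ _ => rfl) rfl
  have h2 : DependsOnFirst n fun ω : Path D => f ω * ∏ j ∈ Finset.range n, g (W j ω) :=
    hfn.mul fun ω ω' h _ _ => Finset.prod_congr rfl fun j hj => by rw [h j (Finset.mem_range.1 hj)]
  rw [h1, lintegral_fiber' _ _ _ (by fun_prop), lintegral_fiber' _ _ _ (by fun_prop)]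
  refine lintegral_congr fun w => ?_
  refine (lintegral_iid_withDensity μ μ' hk hμ n (by fun_prop) fun x x' hx =>
    h2 (w, x, θ) (w, x', θ) (fun _ _ => rfl) hx rfl).trans (lintegral_congr fun x => ?_)
  rw [Finset.prod_mul_distrib, mul_assoc]
  congr 1
  exact mul_comm _ _

/-- Integration over the event of exactly `n` arrivals up to time `t`. -/
theorem setLIntegral_N_eq (t : ℝ≥0) (n : ℕ) {f : Path D → ℝ≥0∞} (hf : Measurable f)
    (hfn : DependsOnFirst n f) :
    ∫⁻ ω in {ω | N t ω = n}, f ω ∂fiber l μ θ =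
      ∫⁻ ω, (Set.Iic (t : ℝ)).indicator 1 (T n ω) * f ω * l {u | (t : ℝ) - T n ω < u}
        ∂fiber l μ θ := by
  have hE := measurableSet_N_eq (D := D) t n
  have hlm : Measurable fun s : ℝ => l {u : Υ | (t : ℝ) - s < u} := by
    refine Monotone.measurable fun s s' hs => measure_mono ?_
    exact fun u (hu : (t : ℝ) - s < u) => (sub_le_sub_left hs _).trans_lt hu
  have hF : Measurable fun ω : Path D => (Set.Iic (t : ℝ)).indicator (1 : ℝ → ℝ≥0∞) (T n ω) * f ω *
      l {u | (t : ℝ) - T n ω < u} :=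
    (((measurable_one.indicator measurableSet_Iic).comp (measurable_T n)).mul hf).mul
      (hlm.comp (measurable_T n))
  rw [← lintegral_indicator hE, lintegral_fiber _ _ _ (hf.indicator hE), lintegral_fiber _ _ _ hF]
  refine lintegral_congr fun x => ?_
  have hf' : Measurable fun w : ℕ → Υ => {ω : Path D | N t ω = n}.indicator f (w, x, θ) :=
    (hf.indicator hE).comp (by fun_prop)
  rw [iid, lintegral_infinitePi_eq_lintegral_update _ n hf']
  refine lintegral_congr fun w => ?_
  have hup : ∀ u : Υ, ∀ k < n, W k ((Function.update w n u, x, θ) : Path D) =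
      W k ((w, x, θ) : Path D) := fun u k hk => Function.update_of_ne hk.ne _ _
  -- The event is `T n ≤ t < T n + W n`, and neither `T n` nor `f` involves coordinate `n`. Only the
  -- tail indicator depends on the resampled value `u`.
  have hval : ∀ u : Υ, {ω : Path D | N t ω = n}.indicator f (Function.update w n u, x, θ) =
      ((Set.Iic (t : ℝ)).indicator 1 (T n ((w, x, θ) : Path D)) * f (w, x, θ)) *
        {u : Υ | (t : ℝ) - T n ((w, x, θ) : Path D) < u}.indicator 1 u := by
    intro u
    have hT := T_congr (hup u)
    have hN : N t ((Function.update w n u, x, θ) : Path D) = n ↔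
        T n ((w, x, θ) : Path D) ≤ t ∧ (t : ℝ) - T n ((w, x, θ) : Path D) < u := by
      rw [N_eq_coe_iff, T_succ, hT, sub_lt_iff_lt_add']
      have : W n ((Function.update w n u, x, θ) : Path D) = u := by simp [W]
      rw [this]
    by_cases h1 : T n ((w, x, θ) : Path D) ≤ t
    · by_cases h2 : (t : ℝ) - T n ((w, x, θ) : Path D) < u
      · rw [Set.indicator_of_mem (show _ ∈ {ω : Path D | N t ω = n} from hN.2 ⟨h1, h2⟩),
          Set.indicator_of_mem (show _ ∈ Set.Iic (t : ℝ) from h1),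
          Set.indicator_of_mem (show u ∈ {u : Υ | (t : ℝ) - T n ((w, x, θ) : Path D) < u} from h2)]
        simpa using hfn _ _ (hup u) (fun _ _ => rfl) rfl
      · rw [Set.indicator_of_notMem (show _ ∉ {ω : Path D | N t ω = n} from
            fun h => h2 (hN.1 h).2),
          Set.indicator_of_notMem (show u ∉ {u : Υ | (t : ℝ) - T n ((w, x, θ) : Path D) < u} from
            h2), mul_zero]
    · rw [Set.indicator_of_notMem (show _ ∉ {ω : Path D | N t ω = n} from
            fun h => h1 (hN.1 h).1),
          Set.indicator_of_notMem (show _ ∉ Set.Iic (t : ℝ) from h1), zero_mul, zero_mul]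
  have hmU : MeasurableSet {u : Υ | (t : ℝ) - T n ((w, x, θ) : Path D) < u} :=
    measurableSet_lt measurable_const measurable_subtype_coe
  simp_rw [hval]
  rw [lintegral_const_mul _ (measurable_one.indicator hmU), lintegral_indicator_one hmU]

end Fiber

/-- Keep the first `n` interarrival times and claims, and let the next arrival happen after time
`t`. -/
noncomputable def truncate (t : ℝ≥0) (n : ℕ) (ω : Path D) : Path D :=
  (fun k => if k < n then W k ω else ⟨t + 1, Set.mem_Ioi.2 (by positivity)⟩,
    fun k => if k < n then X k ω else ⟨1, Set.mem_Ioi.2 one_pos⟩, Θ ω)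

theorem measurable_truncate (t : ℝ≥0) (n : ℕ) :
    Measurable (truncate t n : Path D → Path D) := by
  refine Measurable.prodMk (measurable_pi_lambda _ fun k => ?_)
    (Measurable.prodMk (measurable_pi_lambda _ fun k => ?_) measurable_Θ) <;>
  · split_ifs <;> fun_prop

theorem T_nonneg (n : ℕ) (ω : Path D) : 0 ≤ T n ω :=
  Finset.sum_nonneg fun j _ => (W j ω).2.le

theorem S_truncate {s t : ℝ≥0} (hst : s ≤ t) {n : ℕ} {ω : Path D} (h : N t ω = n) :
    S s (truncate t n ω) = S s ω := by
  obtain ⟨h1, h2⟩ := N_eq_coe_iff.1 h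
  have hW : ∀ k < n, W k (truncate t n ω) = W k ω := fun k hk => if_pos hk
  have hX : ∀ k < n, X k (truncate t n ω) = X k ω := fun k hk => if_pos hk
  have h3 : (t : ℝ) < T (n + 1) (truncate t n ω) := by
    have : (W n (truncate t n ω) : ℝ) = t + 1 := by simp [truncate, W]
    rw [T_succ, this]
    linarith [T_nonneg n (truncate t n ω)]
  have hs : (s : ℝ) ≤ t := hst
  refine tsum_congr fun k => ?_
  by_cases hk : k < n
  · have hT : T (k + 1) (truncate t n ω) = T (k + 1) ω := T_congr fun j hj => hW j (by omega)
    simp only [Set.indicator, Set.mem_ofPred_eq, hT, hX k hk]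
  · have hmono : ∀ ω' : Path D, T (n + 1) ω' ≤ T (k + 1) ω' := fun ω' =>
      (T_strictMono ω').monotone (by omega)
    rw [Set.indicator_of_notMem, Set.indicator_of_notMem]
    · exact not_le.2 (hs.trans_lt (h2.trans_le (hmono _)))
    · exact not_le.2 (hs.trans_lt (h3.trans_le (hmono _)))

/-- Up to time `t`, an event of `F t` with exactly `n` arrivals only depends on the first `n`
interarrival times and claims. -/
theorem truncate_mem_iff {t : ℝ≥0} {n : ℕ} {A : Set (Path D)} (hA : MeasurableSet[F D t] A)
    {ω : Path D} (h : N t ω = n) : truncate t n ω ∈ A ↔ ω ∈ A := by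
  have hΘ : ∀ ω' ∈ {ω' : Path D | N t ω' = n}, Θ (truncate t n ω') = Θ ω' := fun _ _ => rfl
  have hS : ∀ ω' ∈ {ω' : Path D | N t ω' = n}, ∀ s ≤ t, S s (truncate t n ω') = S s ω' :=
    fun ω' hω' s hs => S_truncate hs hω'
  exact mem_iff_of_measurableSet_F hΘ hS hA ω h

/-- The indicator of `A` may depend on the whole path; its pullback under `truncate` does not, and
agrees with it on `{N t = n}` when `A` belongs to `F D t`. -/
theorem dependsOnFirst_truncate (t : ℝ≥0) (n : ℕ) (A : Set (Path D)) :
    DependsOnFirst n ((truncate t n ⁻¹' A).indicator 1) := by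
  intro ω ω' h1 h2 h3
  have : truncate t n ω = truncate t n ω' := by
    refine Prod.ext (funext fun k => ?_) (Prod.ext (funext fun k => ?_) h3)
    · simp only [truncate]; split_ifs with hk
      · exact h1 k hk
      · rfl
    · simp only [truncate]; split_ifs with hk
      · exact h2 k hk
      · rfl
  exact congrArg (A.indicator (1 : Path D → ℝ≥0∞)) this

section Fiber

variable (l l' μ μ' : Measure Υ) [IsProbabilityMeasure l] [IsProbabilityMeasure l']
  [IsProbabilityMeasure μ] [IsProbabilityMeasure μ'] (θ : D)

/-- A renewal process does not explode. -/
theorem fiber_N_eq_top (t : ℝ≥0) : fiber l μ θ {ω | N t ω = ⊤} = 0 := by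
  set E : Set (Path D) := {ω | N t ω = ⊤}
  have hE : MeasurableSet E := measurableSet_N_eq t ⊤
  let e : Υ → ℝ≥0∞ := fun u => ENNReal.ofReal (Real.exp (-(u : ℝ)))
  have he : Measurable e := by fun_prop
  set c := ∫⁻ u, e u ∂l
  have hlt : ∀ u, e u < 1 := fun u => by
    rw [ENNReal.ofReal_lt_one, Real.exp_lt_one_iff]
    exact neg_lt_zero.2 u.2
  have hc : c < 1 := by
    have hle : c ≤ 1 := (lintegral_mono fun u => (hlt u).le).trans (by simp)
    have := lintegral_strict_mono (μ := l) (g := fun _ => 1) (NeZero.ne l) aemeasurable_const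
      (ne_top_of_le_ne_top ENNReal.one_ne_top hle) (.of_forall hlt)
    simpa using this
  -- Exponential Markov bound: on explosion every `T n` is at most `t`, while the mean of `exp (-T
  -- n)` is `c ^ n`, with `c < 1` because interarrival times are positive.
  have hbound : ∀ n : ℕ, ENNReal.ofReal (Real.exp (-t)) * fiber l μ θ E ≤ c ^ n := by
    intro n
    have hW : Measurable fun (ω : Path D) n => W n ω := by fun_prop
    have hcn : c ^ n = ∫⁻ ω, ∏ j ∈ Finset.range n, e (W j ω) ∂fiber l μ θ := by
      have := lintegral_prod_infinitePi (fun _ => l) (Finset.range n) (f := fun _ => e)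
        fun _ => he
      rw [Finset.prod_const, Finset.card_range] at this
      have h2 := lintegral_map (μ := fiber l μ θ)
        (f := fun w : ℕ → Υ => ∏ j ∈ Finset.range n, e (w j)) (by fun_prop) hW
      rw [map_interarrivals_fiber] at h2
      exact this.symm.trans h2
    rw [hcn, ← setLIntegral_const]
    refine (setLIntegral_mono (by fun_prop) fun ω hω => ?_).trans (setLIntegral_le_lintegral E _)
    rw [← ENNReal.ofReal_prod_of_nonneg fun _ _ => (Real.exp_pos _).le, ← Real.exp_sum,
      Finset.sum_neg_distrib]
    exact ENNReal.ofReal_le_ofReal (Real.exp_le_exp.2 (neg_le_neg (N_eq_top_iff.1 hω n)))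
  have h0 : ENNReal.ofReal (Real.exp (-t)) * fiber l μ θ E ≤ 0 :=
    ge_of_tendsto' (ENNReal.tendsto_pow_atTop_nhds_zero_of_lt_one hc) hbound
  rcases mul_eq_zero.1 (nonpos_iff_eq_zero.1 h0) with h | h
  · exact absurd (ENNReal.ofReal_eq_zero.1 h) (not_le.2 (Real.exp_pos _))
  · exact h

theorem setLIntegral_eq_tsum_N {ν : Measure (Path D)} {t : ℝ≥0} (h : ν {ω | N t ω = ⊤} = 0)
    {A : Set (Path D)} (hA : MeasurableSet A) (f : Path D → ℝ≥0∞) :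
    ∫⁻ ω in A, f ω ∂ν = ∑' n : ℕ, ∫⁻ ω in A ∩ {ω | N t ω = n}, f ω ∂ν := by
  rw [← lintegral_iUnion (s := fun n : ℕ => A ∩ {ω | N t ω = n})
    (fun n => hA.inter (measurableSet_N_eq t n)) ?_]
  · refine setLIntegral_congr ?_
    filter_upwards [measure_eq_zero_iff_ae_notMem.1 h] with ω hω
    refine propext ⟨fun hωA => ?_, fun h => ?_⟩
    · obtain ⟨n, hn⟩ := ENat.ne_top_iff_exists.1 hω
      exact Set.mem_iUnion.2 ⟨n, hωA, hn.symm⟩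
    · obtain ⟨n, hn⟩ := Set.mem_iUnion.1 h
      exact hn.1
  · intro i j hij
    refine Set.disjoint_left.2 fun ω hi hj => hij ?_
    exact Nat.cast_injective (R := ℕ∞) (hi.2.symm.trans hj.2)

theorem setLIntegral_inter_N {ν : Measure (Path D)} {t : ℝ≥0} {n : ℕ} {A : Set (Path D)}
    (hA : MeasurableSet[F D t] A) {f f' : Path D → ℝ≥0∞} (hf : ∀ ω, N t ω = n → f ω = f' ω) :
    ∫⁻ ω in A ∩ {ω | N t ω = n}, f ω ∂ν =
      ∫⁻ ω in {ω | N t ω = n}, (truncate t n ⁻¹' A).indicator 1 ω * f' ω ∂ν := by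
  rw [← setLIntegral_indicator (F_le t _ hA)]
  refine setLIntegral_congr_fun (measurableSet_N_eq t n) fun ω hω => ?_
  by_cases h : ω ∈ A
  · have h' : ω ∈ truncate t n ⁻¹' A := (truncate_mem_iff hA hω).2 h
    simp [h, h', hf ω hω]
  · have h' : ω ∉ truncate t n ⁻¹' A := fun h' => h ((truncate_mem_iff hA hω).1 h')
    simp [h, h']

/-- The density on `F t` of one renewal fibre with respect to another. -/
noncomputable def fiberDensity (g k : Υ → ℝ≥0∞) (t : ℝ≥0) (ω : Path D) : ℝ≥0∞ :=
  (∏ j ∈ Finset.range (N t ω).toNat, k (X j ω) * g (W j ω)) *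
    (l' {u | (t : ℝ) - T (N t ω).toNat ω < u} / l {u | (t : ℝ) - T (N t ω).toNat ω < u})

theorem measurable_tail (l : Measure Υ) : Measurable fun s : ℝ => l {u : Υ | s < u} := by
  refine Antitone.measurable fun s s' hs => measure_mono ?_
  exact fun u (hu : s' < u) => hs.trans_lt hu

/-- Split by the number of arrivals, integrate out the overshooting interarrival time under both
measures, and change the law of the first `n` variables. The tail of `l'` from one side is matched
by the tail ratio times the tail of `l` on the other. -/
theorem fiber_apply_eq_setLIntegral {g k : Υ → ℝ≥0∞} (hg : Measurable g) (hk : Measurable k)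
    (hl : l' = l.withDensity g) (hμ : μ' = μ.withDensity k) {t : ℝ≥0} {A : Set (Path D)}
    (hA : MeasurableSet[F D t] A) :
    fiber l' μ' θ A = ∫⁻ ω in A, fiberDensity l l' g k t ω ∂fiber l μ θ := by
  rw [← setLIntegral_one, setLIntegral_eq_tsum_N (fiber_N_eq_top l' μ' θ t) (F_le t _ hA),
    setLIntegral_eq_tsum_N (fiber_N_eq_top l μ θ t) (F_le t _ hA)]
  refine tsum_congr fun n => ?_
  have htail := measurable_tail l
  have htail' := measurable_tail l'
  have hι : Measurable ((truncate t n ⁻¹' A).indicator (1 : Path D → ℝ≥0∞)) :=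
    measurable_one.indicator (measurable_truncate t n (F_le t _ hA))
  have hdι := dependsOnFirst_truncate t n A
  have hI : Measurable fun ω : Path D => (Set.Iic (t : ℝ)).indicator (1 : ℝ → ℝ≥0∞) (T n ω) :=
    (measurable_one.indicator measurableSet_Iic).comp (measurable_T n)
  let R : ℝ → ℝ≥0∞ := fun s => l' {u | (t : ℝ) - s < u} / l {u | (t : ℝ) - s < u}
  have hR : Measurable fun ω : Path D => R (T n ω) :=
    (htail'.comp (by fun_prop)).div (htail.comp (by fun_prop))
  have hb : Measurable fun ω : Path D => l' {u | (t : ℝ) - T n ω < u} :=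
    htail'.comp (by fun_prop)
  have hprod : DependsOnFirst n fun ω : Path D =>
      ∏ j ∈ Finset.range n, k (X j ω) * g (W j ω) := fun ω ω' h1 h2 _ =>
    Finset.prod_congr rfl fun j hj => by
      rw [h1 j (Finset.mem_range.1 hj), h2 j (Finset.mem_range.1 hj)]
  have m1 : Measurable fun ω : Path D => (truncate t n ⁻¹' A).indicator (1 : Path D → ℝ≥0∞) ω * 1 :=
    hι.mul measurable_const
  have d1 : DependsOnFirst n fun ω : Path D =>
      (truncate t n ⁻¹' A).indicator (1 : Path D → ℝ≥0∞) ω * 1 := hdι.mul fun _ _ _ _ _ => rfl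
  have m2 : Measurable fun ω : Path D => (truncate t n ⁻¹' A).indicator (1 : Path D → ℝ≥0∞) ω *
      ((∏ j ∈ Finset.range n, k (X j ω) * g (W j ω)) * R (T n ω)) :=
    hι.mul (Measurable.mul (by fun_prop) hR)
  have d2 : DependsOnFirst n fun ω : Path D =>
      (truncate t n ⁻¹' A).indicator (1 : Path D → ℝ≥0∞) ω *
      ((∏ j ∈ Finset.range n, k (X j ω) * g (W j ω)) * R (T n ω)) :=
    hdι.mul (hprod.mul (dependsOnFirst_T n R))
  rw [setLIntegral_inter_N hA (f' := fun _ => 1) (fun _ _ => rfl),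
    setLIntegral_inter_N hA (f' := fun ω => (∏ j ∈ Finset.range n, k (X j ω) * g (W j ω)) *
      R (T n ω)) (fun ω hω => by simp only [fiberDensity, hω, ENat.toNat_natCast, R]),
    setLIntegral_N_eq l' μ' θ t n m1 d1, setLIntegral_N_eq l μ θ t n m2 d2]
  refine (lintegral_fiber_withDensity l l' μ μ' θ hg hk hl hμ n (f := fun ω =>
    (Set.Iic (t : ℝ)).indicator 1 (T n ω) * ((truncate t n ⁻¹' A).indicator 1 ω * 1) *
        l' {u | (t : ℝ) - T n ω < u}) ((hI.mul m1).mul hb)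
      (((dependsOnFirst_T n _).mul d1).mul
        (dependsOnFirst_T n fun s => l' {u | (t : ℝ) - s < u}))).trans ?_
  refine lintegral_congr fun ω => ?_
  -- Where the tail of `l` vanishes the quotient is meaningless, but by absolute continuity the tail
  -- of `l'` vanishes too.
  have hRl : R (T n ω) * l {u | (t : ℝ) - T n ω < u} = l' {u | (t : ℝ) - T n ω < u} := by
    rcases eq_or_ne (l {u | (t : ℝ) - T n ω < u}) 0 with h0 | h0
    · rw [h0, mul_zero, hl, withDensity_absolutelyContinuous l g h0]
    · exact ENNReal.div_mul_cancel h0 (measure_ne_top _ _)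
  rw [← hRl]
  ring

end Fiber

/-! ### Progressive equivalence of renewal processes -/

theorem progAC_fiber {l l' μ μ' : Measure Υ} [IsProbabilityMeasure l] [IsProbabilityMeasure l']
    [IsProbabilityMeasure μ] [IsProbabilityMeasure μ'] (hl : l' ≪ l) (hμ : μ' ≪ μ) (θ : D) :
    ProgAC (fiber l' μ' θ) (fiber l μ θ) := by
  intro t A hA h0
  rw [fiber_apply_eq_setLIntegral l l' μ μ' θ (Measure.measurable_rnDeriv l' l)
    (Measure.measurable_rnDeriv μ' μ) (Measure.withDensity_rnDeriv_eq _ _ hl).symm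
    (Measure.withDensity_rnDeriv_eq _ _ hμ).symm hA]
  exact setLIntegral_measure_zero A _ h0

theorem progAC_model {m m' : Measure D} {L L' : Kernel D Υ} [IsMarkovKernel L] [IsMarkovKernel L']
    {μ μ' : Measure Υ} [IsProbabilityMeasure μ] [IsProbabilityMeasure μ'] (hm : m' ≪ m)
    (hL : ∀ᵐ θ ∂m, L' θ ≪ L θ) (hμ : μ' ≪ μ) : ProgAC (model m' L' μ') (model m L μ) := by
  intro t A hA h0
  have hA' := F_le t _ hA
  rw [model_apply _ _ _ hA'] at h0 ⊢
  have hmeas : ∀ (L : Kernel D Υ) [IsMarkovKernel L] (μ : Measure Υ) [IsProbabilityMeasure μ],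
      Measurable fun θ => fiber (L θ) μ θ A := fun L _ μ _ => by
    simp_rw [← fiberKernel_apply]
    exact (fiberKernel L μ).measurable_coe hA'
  rw [lintegral_eq_zero_iff (hmeas L μ)] at h0
  rw [lintegral_eq_zero_iff (hmeas L' μ')]
  filter_upwards [hm.ae_le h0, hm.ae_le hL] with θ h1 h2
  exact progAC_fiber h2 hμ θ t A hA h1

theorem progEquiv_iff {Q P : Measure (Path D)} : ProgEquiv Q P ↔ ProgAC Q P ∧ ProgAC P Q :=
  ⟨fun h => ⟨fun t A hA => (h t A hA).2, fun t A hA => (h t A hA).1⟩,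
    fun h t A hA => ⟨h.2 t A hA, h.1 t A hA⟩⟩

/-! ### Real valued densities -/

theorem hasProgDensity_of_setLIntegral {Q P : Measure (Path D)} [IsProbabilityMeasure Q]
    {M : ℝ≥0 → Path D → ℝ} (hM : ∀ t, AEStronglyMeasurable (M t) P) (h0 : ∀ t, 0 ≤ᵐ[P] M t)
    (h : ∀ (t : ℝ≥0) (A : Set (Path D)), MeasurableSet[F D t] A →
      ∫⁻ ω in A, ENNReal.ofReal (M t ω) ∂P = Q A) : HasProgDensity Q P M := by
  intro u t hut
  refine ⟨⟨hM t, ?_⟩, fun A hA => ?_⟩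
  · have := h t Set.univ .univ
    rw [Measure.restrict_univ, measure_univ] at this
    rw [hasFiniteIntegral_iff_ofReal (h0 t), this]
    exact ENNReal.one_lt_top
  · rw [integral_eq_lintegral_of_nonneg_ae (ae_restrict_of_ae (h0 t)) (hM t).restrict,
      h t A (F_mono hut A hA), measureReal_def]

/-- All uniqueness claims about pairs and measures go through this: the density process fixes `Q` on
a generating filtration. -/
theorem HasProgDensity.eq {Q Q' P : Measure (Path D)} [IsProbabilityMeasure Q]
    [IsProbabilityMeasure Q'] {M : ℝ≥0 → Path D → ℝ} (h : HasProgDensity Q P M)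
    (h' : HasProgDensity Q' P M) : Q = Q' := by
  refine ext_of_F fun t A hA => ?_
  rw [← measureReal_eq_measureReal_iff, (h t t le_rfl).2 A hA, (h' t t le_rfl).2 A hA]

theorem one_sub_distFun (l : Measure Υ) [IsProbabilityMeasure l] (x : ℝ) :
    1 - distFun l x = (l {u | x < u}).toReal := by
  have hm : MeasurableSet {w : Υ | (w : ℝ) ≤ x} :=
    measurableSet_le measurable_subtype_coe measurable_const
  rw [distFun, ← probReal_compl_eq_one_sub hm]
  congr 2
  ext u; simp

theorem hInv_pos (h : Υ → ℝ) (y : ℝ) : 0 < hInv h y := (Function.invFun h y).2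

theorem hInv_apply {h : Υ → ℝ} (hinj : Function.Injective h) (x : Υ) : hInv h (h x) = x := by
  rw [hInv, Function.leftInverse_invFun hinj x]

theorem eq_of_hInv_eq {h : Υ → ℝ} (hinj : Function.Injective h) {y y' : ℝ}
    (hy : y ∈ Set.range h) (hy' : y' ∈ Set.range h) (he : hInv h y = hInv h y') : y = y' := by
  obtain ⟨x, rfl⟩ := hy
  obtain ⟨x', rfl⟩ := hy'
  rw [hInv_apply hinj, hInv_apply hinj] at he
  rw [Subtype.ext he]

/-- An injective Borel map on a standard Borel space has a measurable left inverse, and on the range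
of `h` it agrees with `hInv h`. -/
theorem measurable_hInv_comp {h : Υ → ℝ} (hmeas : Measurable h) (hinj : Function.Injective h)
    {γ : Υ → ℝ} (hγ : Measurable γ) (hr : ∀ x, γ x ∈ Set.range h) :
    Measurable fun x => hInv h (γ x) := by
  have : StandardBorelSpace Υ := measurableSet_Ioi.standardBorel
  have hemb := hmeas.measurableEmbedding hinj
  have hΥ : Nonempty Υ := ⟨⟨1, Set.mem_Ioi.2 one_pos⟩⟩
  have : (fun x => hInv h (γ x)) = fun x => ((hemb.invFun (γ x) : Υ) : ℝ) := by
    ext x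
    obtain ⟨y, hy⟩ := hr x
    rw [← hy, hInv_apply hinj, hemb.leftInverse_invFun]
  rw [this]
  exact measurable_subtype_coe.comp (hemb.measurable_invFun.comp hγ)

section Density

variable {h γ : Υ → ℝ} {r : D → Υ → ℝ}

/-- A version `r` may be negative on a null set, so nonnegativity is required along the path. -/
theorem densFiber_eq_toReal {L K : D → Measure Υ} {θ : D} [IsProbabilityMeasure (L θ)]
    [IsProbabilityMeasure (K θ)] (t : ℝ≥0) {ω : Path D} (hr : ∀ j, 0 ≤ r θ (W j ω)) :
    densFiber h γ r L K θ t ω =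
      (fiberDensity (K θ) (L θ) (fun w => ENNReal.ofReal (r θ w))
        (fun x => ENNReal.ofReal (hInv h (γ x))) t ω).toReal := by
  rw [densFiber, fiberDensity, ENNReal.toReal_mul, ENNReal.toReal_prod, ENNReal.toReal_div,
    one_sub_distFun, one_sub_distFun]
  congr 1
  refine Finset.prod_congr rfl fun j _ => ?_
  rw [ENNReal.toReal_mul, ENNReal.toReal_ofReal (hInv_pos h _).le, ENNReal.toReal_ofReal (hr j)]

theorem measurable_distFun (L : Kernel D Υ) [IsMarkovKernel L] :
    Measurable fun q : D × ℝ => distFun (L q.1) q.2 := by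
  have hs : MeasurableSet {q : (D × ℝ) × Υ | (q.2 : ℝ) ≤ q.1.2} :=
    measurableSet_le (by fun_prop) (by fun_prop)
  have := Kernel.measurable_kernel_prodMk_left (κ := L.comap Prod.fst measurable_fst) hs
  exact this.ennreal_toReal

theorem measurable_densFiber (hγ : Measurable fun x => hInv h (γ x))
    (hr : Measurable (Function.uncurry r)) (L K : Kernel D Υ) [IsMarkovKernel L]
    [IsMarkovKernel K] (t : ℝ≥0) :
    Measurable fun q : D × Path D => densFiber h γ r (fun θ => L θ) (fun θ => K θ) q.1 t q.2 := by
  -- The number of factors is random; treating it as a separate discrete variable reduces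
  -- measurability to fixed `n`.
  let G : ℕ × (D × Path D) → ℝ := fun z =>
    (∏ j ∈ Finset.range z.1, hInv h (γ (X j z.2.2)) * r z.2.1 (W j z.2.2)) *
      ((1 - distFun (L z.2.1) ((t : ℝ) - T z.1 z.2.2)) /
        (1 - distFun (K z.2.1) ((t : ℝ) - T z.1 z.2.2)))
  have hG : Measurable G := by
    refine measurable_from_prod_countable_right fun n => ?_
    have h1 : ∀ j, Measurable fun q : D × Path D => hInv h (γ (X j q.2)) := fun j =>
      hγ.comp (by fun_prop)
    have h2 : ∀ j, Measurable fun q : D × Path D => r q.1 (W j q.2) := fun j =>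
      hr.comp (f := fun q : D × Path D => (q.1, W j q.2)) (by fun_prop)
    have h3 : ∀ (L : Kernel D Υ) [IsMarkovKernel L],
        Measurable fun q : D × Path D => distFun (L q.1) ((t : ℝ) - T n q.2) := fun L _ =>
      (measurable_distFun L).comp (f := fun q : D × Path D => (q.1, (t : ℝ) - T n q.2))
        (by fun_prop)
    have e1 : Measurable fun q : D × Path D =>
        ∏ j ∈ Finset.range n, hInv h (γ (X j q.2)) * r q.1 (W j q.2) :=
      Finset.measurable_prod _ fun j _ => (h1 j).mul (h2 j)
    have e2 : Measurable fun q : D × Path D => (1 - distFun (L q.1) ((t : ℝ) - T n q.2)) /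
        (1 - distFun (K q.1) ((t : ℝ) - T n q.2)) := ((h3 L).const_sub 1).div ((h3 K).const_sub 1)
    exact e1.mul e2
  have hN : Measurable fun q : D × Path D => ((N t q.2).toNat, q) :=
    ((measurable_from_top (f := ENat.toNat)).comp ((measurable_N t).comp measurable_snd)).prodMk
      measurable_id
  have hGN : (fun q : D × Path D => densFiber h γ r (fun θ => L θ) (fun θ => K θ) q.1 t q.2) =
      fun q => G ((N t q.2).toNat, q) := by
    ext q
    simp only [densFiber, G]
  rw [hGN]
  exact hG.comp hN

theorem measurable_dens (hγ : Measurable fun x => hInv h (γ x))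
    (hr : Measurable (Function.uncurry r)) {ξ : D → ℝ} (hξ : Measurable ξ) (L K : Kernel D Υ)
    [IsMarkovKernel L] [IsMarkovKernel K] (t : ℝ≥0) :
    Measurable (dens h γ ξ r (fun θ => L θ) (fun θ => K θ) t) := by
  have e1 : Measurable fun ω : Path D => (Θ ω, ω) := measurable_Θ.prodMk measurable_id
  have e2 := Measurable.comp (measurable_densFiber hγ hr L K t) e1
  have e3 : Measurable fun ω : Path D => ξ (Θ ω) := hξ.comp measurable_Θ
  unfold dens
  exact e3.mul e2

theorem withDensity_ofReal_eq {l l' : Measure Υ} [IsProbabilityMeasure l]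
    [IsProbabilityMeasure l'] (hac : l' ≪ l) {f : Υ → ℝ}
    (hf : f =ᵐ[l] fun w => (l'.rnDeriv l w).toReal) :
    l' = l.withDensity fun w => ENNReal.ofReal (f w) := by
  conv_lhs => rw [← Measure.withDensity_rnDeriv_eq _ _ hac]
  refine withDensity_congr_ae ?_
  filter_upwards [hf, Measure.rnDeriv_lt_top l' l] with w h1 h2
  rw [h1, ENNReal.ofReal_toReal h2.ne]

variable (L K : Kernel D Υ) [IsMarkovKernel K] {μ μ' : Measure Υ}
  [IsProbabilityMeasure μ] [IsProbabilityMeasure μ'] {θ : D}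

theorem ae_nonneg_deriv (hrae : r θ =ᵐ[K θ] fun w => ((L θ).rnDeriv (K θ) w).toReal) :
    ∀ᵐ ω ∂fiber (K θ) μ θ, ∀ j, 0 ≤ r θ (W j ω) := by
  rw [ae_all_iff]
  intro j
  have : ∀ᵐ w ∂(fiber (K θ) μ θ).map (W j), 0 ≤ r θ w := by
    rw [map_W_fiber]
    filter_upwards [hrae] with w hw
    rw [hw]; exact ENNReal.toReal_nonneg
  exact ae_of_ae_map (measurable_W j).aemeasurable this

variable [IsMarkovKernel L]

theorem ae_nonneg_densFiber (hrae : r θ =ᵐ[K θ] fun w => ((L θ).rnDeriv (K θ) w).toReal)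
    (t : ℝ≥0) : 0 ≤ᵐ[fiber (K θ) μ θ] densFiber h γ r (fun θ => L θ) (fun θ => K θ) θ t := by
  filter_upwards [ae_nonneg_deriv L K (μ := μ) hrae] with ω hω
  rw [densFiber_eq_toReal t hω]
  exact ENNReal.toReal_nonneg

theorem setLIntegral_densFiber (hγ : Measurable fun x => hInv h (γ x))
    (hr : Measurable (Function.uncurry r)) (hac : L θ ≪ K θ)
    (hrae : r θ =ᵐ[K θ] fun w => ((L θ).rnDeriv (K θ) w).toReal)
    (hμ : μ' = μ.withDensity fun x => ENNReal.ofReal (hInv h (γ x))) {t : ℝ≥0}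
    {A : Set (Path D)} (hA : MeasurableSet[F D t] A) :
    ∫⁻ ω in A, ENNReal.ofReal (densFiber h γ r (fun θ => L θ) (fun θ => K θ) θ t ω)
      ∂fiber (K θ) μ θ = fiber (L θ) μ' θ A := by
  have hg : Measurable fun w => ENNReal.ofReal (r θ w) :=
    (hr.comp (f := fun w => (θ, w)) (by fun_prop)).ennreal_ofReal
  have hl := withDensity_ofReal_eq hac hrae
  rw [fiber_apply_eq_setLIntegral (K θ) (L θ) μ μ' θ hg hγ.ennreal_ofReal hl hμ hA]
  refine lintegral_congr_ae (ae_restrict_of_ae ?_)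
  filter_upwards [ae_nonneg_deriv L K (μ := μ) hrae] with ω hω
  rw [densFiber_eq_toReal t hω, ENNReal.ofReal_toReal]
  refine ENNReal.mul_ne_top (ENNReal.prod_ne_top fun j _ =>
    ENNReal.mul_ne_top ENNReal.ofReal_ne_top ENNReal.ofReal_ne_top) fun htop => ?_
  -- An infinite tail ratio would need a zero denominator under a nonzero numerator, against `L θ ≪
  -- K θ`, or an infinite numerator.
  rcases ENNReal.div_eq_top.1 htop with ⟨h1, h2⟩ | ⟨h1, -⟩
  · exact h1 (hac h2)
  · exact measure_ne_top _ _ h1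

theorem hasProgDensity_fiber (hγ : Measurable fun x => hInv h (γ x))
    (hr : Measurable (Function.uncurry r)) (hac : L θ ≪ K θ)
    (hrae : r θ =ᵐ[K θ] fun w => ((L θ).rnDeriv (K θ) w).toReal)
    (hμ : μ' = μ.withDensity fun x => ENNReal.ofReal (hInv h (γ x))) :
    HasProgDensity (fiber (L θ) μ' θ) (fiber (K θ) μ θ)
      (densFiber h γ r (fun θ => L θ) (fun θ => K θ) θ) :=
  hasProgDensity_of_setLIntegral
    (fun t => ((measurable_densFiber hγ hr L K t).comp
      (measurable_prodMk_left (x := θ))).aestronglyMeasurable)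
    (fun t => ae_nonneg_densFiber L K hrae t)
    fun _ _ hA => setLIntegral_densFiber L K hγ hr hac hrae hμ hA

theorem ae_model {m : Measure D} {s : Set (Path D)} (hs : MeasurableSet s)
    (hae : ∀ᵐ θ ∂m, ∀ᵐ ω ∂fiber (K θ) μ θ, ω ∈ s) : ∀ᵐ ω ∂model m K μ, ω ∈ s := by
  change model m K μ sᶜ = 0
  rw [model_apply _ _ _ hs.compl, lintegral_eq_zero_iff (by
    simp_rw [← fiberKernel_apply]
    exact (fiberKernel K μ).measurable_coe hs.compl)]
  exact hae

theorem hasProgDensity_model {m m' : Measure D} [IsProbabilityMeasure m]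
    [IsProbabilityMeasure m'] (hγ : Measurable fun x => hInv h (γ x))
    (hr : Measurable (Function.uncurry r)) (hac : ∀ᵐ θ ∂m, L θ ≪ K θ)
    (hrae : ∀ᵐ θ ∂m, r θ =ᵐ[K θ] fun w => ((L θ).rnDeriv (K θ) w).toReal)
    (hμ : μ' = μ.withDensity fun x => ENNReal.ofReal (hInv h (γ x)))
    {ξ : D → ℝ} (hξ : Measurable ξ) (hξ0 : ∀ᵐ θ ∂m, 0 < ξ θ)
    (hm : m' = m.withDensity fun θ => ENNReal.ofReal (ξ θ)) :
    HasProgDensity (model m' L μ') (model m K μ)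
      (dens h γ ξ r (fun θ => L θ) (fun θ => K θ)) := by
  have hmeas := measurable_dens hγ hr hξ L K
  refine hasProgDensity_of_setLIntegral (fun t => (hmeas t).aestronglyMeasurable) (fun t => ?_)
    fun t A hA => ?_
  · refine ae_model K (measurableSet_le measurable_const (hmeas t)) ?_
    filter_upwards [hξ0, hrae] with θ h1 h2
    filter_upwards [ae_Θ_eq (K θ) μ θ, ae_nonneg_densFiber L K h2 t] with ω h3 h4
    change 0 ≤ dens h γ ξ r (fun θ => L θ) (fun θ => K θ) t ω
    rw [dens, h3]
    exact mul_nonneg h1.le h4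
  · have hA' := F_le t _ hA
    have hL : Measurable fun θ => fiber (L θ) μ' θ A := by
      simp_rw [← fiberKernel_apply]
      exact (fiberKernel L μ').measurable_coe hA'
    rw [← lintegral_indicator hA', lintegral_model _ _ _ ((hmeas t).ennreal_ofReal.indicator hA'),
      model_apply _ _ _ hA', hm, lintegral_withDensity_eq_lintegral_mul _ hξ.ennreal_ofReal hL]
    refine lintegral_congr_ae ?_
    -- On the fibre at `θ` the factor `ξ (Θ ω)` is the constant `ξ θ`, which turns `m` into `m'`.
    filter_upwards [hξ0, hrae, hac] with θ h1 h2 h3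
    rw [lintegral_indicator hA', Pi.mul_apply,
      ← setLIntegral_densFiber L K hγ hr h3 h2 hμ hA, ← lintegral_const_mul' _ _
        ENNReal.ofReal_ne_top]
    refine lintegral_congr_ae (ae_restrict_of_ae ?_)
    filter_upwards [ae_Θ_eq (K θ) μ θ] with ω h4
    rw [dens, h4, ENNReal.ofReal_mul h1.le]

end Density

/-! ### Positive probability densities. -/

section

variable {α : Type*} [MeasurableSpace α] {m m' : Measure α}

theorem integrable_and_integral_eq_one {f : α → ℝ} (hf : Measurable f) (h0 : ∀ᵐ x ∂m, 0 < f x)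
    [h1 : IsProbabilityMeasure (m.withDensity fun x => ENNReal.ofReal (f x))] :
    Integrable f m ∧ ∫ x, f x ∂m = 1 := by
  have h := h1.measure_univ
  rw [withDensity_apply _ .univ, Measure.restrict_univ] at h
  have h0' : 0 ≤ᵐ[m] f := h0.mono fun x hx => hx.le
  refine ⟨⟨hf.aestronglyMeasurable, ?_⟩, ?_⟩
  · rw [hasFiniteIntegral_iff_ofReal h0', h]; exact ENNReal.one_lt_top
  · rw [integral_eq_lintegral_of_nonneg_ae h0' hf.aestronglyMeasurable, h, ENNReal.toReal_one]

theorem isProbabilityMeasure_withDensity_ofReal {f : α → ℝ} (h0 : ∀ᵐ x ∂m, 0 < f x)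
    (hi : Integrable f m) (h1 : ∫ x, f x ∂m = 1) :
    IsProbabilityMeasure (m.withDensity fun x => ENNReal.ofReal (f x)) := by
  refine ⟨?_⟩
  rw [withDensity_apply _ .univ, Measure.restrict_univ,
    ← ofReal_integral_eq_lintegral_ofReal hi (h0.mono fun x hx => hx.le), h1, ENNReal.ofReal_one]

theorem absolutelyContinuous_withDensity_ofReal {f : α → ℝ} (hf : Measurable f)
    (h0 : ∀ᵐ x ∂m, 0 < f x) : m ≪ m.withDensity fun x => ENNReal.ofReal (f x) :=
  withDensity_absolutelyContinuous' hf.ennreal_ofReal.aemeasurable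
    (h0.mono fun _ hx => (ENNReal.ofReal_pos.2 hx).ne')

theorem ae_eq_of_withDensity_ofReal_eq {f g : α → ℝ} (hf : Measurable f) (hg : Measurable g)
    (hf0 : ∀ᵐ x ∂m, 0 < f x) (hg0 : ∀ᵐ x ∂m, 0 < g x) (hi : Integrable f m)
    (h : (m.withDensity fun x => ENNReal.ofReal (f x)) =
      m.withDensity fun x => ENNReal.ofReal (g x)) : f =ᵐ[m] g := by
  have := (withDensity_eq_iff hf.ennreal_ofReal.aemeasurable hg.ennreal_ofReal.aemeasurable
    (by rw [← ofReal_integral_eq_lintegral_ofReal hi (hf0.mono fun x hx => hx.le)]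
        exact ENNReal.ofReal_ne_top)).1 h
  filter_upwards [this, hf0, hg0] with x h1 h2 h3
  exact (ENNReal.ofReal_eq_ofReal_iff h2.le h3.le).1 h1

/-- Equivalence makes the derivative positive and finite almost everywhere. Resetting it to `1`
elsewhere gives positivity at every point, so that `h` can be applied to it. -/
theorem exists_pos_density [IsProbabilityMeasure m] [IsProbabilityMeasure m'] (h : m' ≪ m)
    (h' : m ≪ m') : ∃ f : α → ℝ, Measurable f ∧ (∀ x, 0 < f x) ∧
      m' = m.withDensity fun x => ENNReal.ofReal (f x) := by
  have hm : Measurable fun x => (m'.rnDeriv m x).toReal :=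
    (Measure.measurable_rnDeriv m' m).ennreal_toReal
  refine ⟨fun x => if 0 < (m'.rnDeriv m x).toReal then (m'.rnDeriv m x).toReal else 1,
    Measurable.ite (measurableSet_lt measurable_const hm) hm measurable_const,
    fun x => by dsimp only; split_ifs with hx <;> [exact hx; exact one_pos], ?_⟩
  conv_lhs => rw [← Measure.withDensity_rnDeriv_eq _ _ h]
  refine withDensity_congr_ae ?_
  filter_upwards [h'.ae_le (Measure.rnDeriv_pos h), Measure.rnDeriv_lt_top m' m] with x h1 h2
  rw [if_pos (ENNReal.toReal_pos h1.ne' h2.ne), ENNReal.ofReal_toReal h2.ne]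

end

/-! ### The three assertions of the theorem for models. -/

section Model

variable {m m' : Measure D} [IsProbabilityMeasure m']
  {L K : Kernel D Υ} [IsMarkovKernel L] [IsMarkovKernel K] {μ μ' : Measure Υ}
  [IsProbabilityMeasure μ] [IsProbabilityMeasure μ']

theorem memM_model (h1 : m' ≪ m) (h2 : m ≪ m') (h3 : ∀ᵐ θ ∂m, L θ ≪ K θ)
    (h4 : ∀ᵐ θ ∂m, K θ ≪ L θ) (h5 : μ' ≪ μ) (h6 : μ ≪ μ') :
    MemM (model m K μ) (fun θ => L θ) (model m' L μ') where
  prob := inferInstance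
  a1 := condIndepWX_model _ _ _
  a2 := indepThetaX_model _ _ _
  progEquiv := progEquiv_iff.2 ⟨progAC_model h1 h3 h5, progAC_model h2 (h1.ae_le h4) h6⟩
  cmrp := isCMRP_model _ _ _

variable [IsProbabilityMeasure m]

/-- The joint law of `Θ` and `W 0` is `m ⊗ₘ L`, whose absolute continuity splits into that of the
base measures and of almost every kernel value. -/
theorem ProgAC.of_model (h : ProgAC (model m' L μ') (model m K μ)) :
    m' ≪ m ∧ (∀ᵐ θ ∂m', L θ ≪ K θ) ∧ μ' ≪ μ := by
  have h1 := h.map_Θ_W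
  rw [map_Θ_W_model, map_Θ_W_model] at h1
  have h2 := h.map_X
  rw [map_X_model, map_X_model] at h2
  exact ⟨Measure.absolutelyContinuous_of_compProd h1, h1.kernel_of_compProd, h2⟩

theorem MemM.exists_eq_model {Q : Measure (Path D)}
    (hQ : MemM (model m K μ) (fun θ => L θ) Q) :
    ∃ (m' : Measure D) (_ : IsProbabilityMeasure m') (μ' : Measure Υ)
      (_ : IsProbabilityMeasure μ'), Q = model m' L μ' ∧ m' ≪ m ∧ m ≪ m' ∧
      (∀ᵐ θ ∂m, L θ ≪ K θ) ∧ (∀ᵐ θ ∂m, K θ ≪ L θ) ∧ μ' ≪ μ ∧ μ ≪ μ' := by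
  have := hQ.prob
  have i1 : IsProbabilityMeasure (Q.map Θ) :=
    Measure.isProbabilityMeasure_map measurable_Θ.aemeasurable
  have i2 : IsProbabilityMeasure (Q.map (X 0)) :=
    Measure.isProbabilityMeasure_map (measurable_X 0).aemeasurable
  have hQeq := hQ.cmrp.eq_model hQ.a1 hQ.a2 rfl rfl
  obtain ⟨h1, h2⟩ := progEquiv_iff.1 hQ.progEquiv
  rw [hQeq] at h1 h2
  obtain ⟨a1, a2, a3⟩ := h1.of_model
  obtain ⟨b1, b2, b3⟩ := h2.of_model
  exact ⟨_, i1, _, i2, hQeq, a1, b1, b1.ae_le a2, b2, a3, b3⟩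

theorem memR_model_iff {ξ : D → ℝ} : MemR (model m K μ) ξ ↔
    Measurable ξ ∧ (∀ᵐ θ ∂m, 0 < ξ θ) ∧ Integrable ξ m ∧ ∫ θ, ξ θ ∂m = 1 := by
  have key : Measurable ξ → (Integrable (fun ω : Path D => ξ (Θ ω)) (model m K μ) ↔
      Integrable ξ m) ∧ ∫ ω : Path D, ξ (Θ ω) ∂model m K μ = ∫ θ, ξ θ ∂m := by
    intro hξ
    have hf := hξ.aestronglyMeasurable (μ := (model m K μ).map Θ)
    have e1 := integrable_map_measure hf measurable_Θ.aemeasurable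
    have e2 := integral_map measurable_Θ.aemeasurable hf
    rw [map_Θ_model] at e1 e2
    exact ⟨e1.symm, e2.symm⟩
  constructor
  · rintro ⟨h1, h2, h3, h4⟩
    rw [map_Θ_model] at h2
    exact ⟨h1, h2, (key h1).1.1 h3, (key h1).2 ▸ h4⟩
  · rintro ⟨h1, h2, h3, h4⟩
    exact ⟨h1, by rwa [map_Θ_model], (key h1).1.2 h3, (key h1).2.trans h4⟩

theorem memF_model_iff {h γ : Υ → ℝ} (hmeas : Measurable h) (hinj : Function.Injective h) :
    MemF (model m K μ) h γ ↔ Measurable γ ∧ (∀ x, γ x ∈ Set.range h) ∧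
      Integrable (fun x => hInv h (γ x)) μ ∧ ∫ x, hInv h (γ x) ∂μ = 1 := by
  have key : Measurable γ → (∀ x, γ x ∈ Set.range h) →
      (Integrable (fun ω : Path D => hInv h (γ (X 0 ω))) (model m K μ) ↔
      Integrable (fun x => hInv h (γ x)) μ) ∧
      ∫ ω : Path D, hInv h (γ (X 0 ω)) ∂model m K μ = ∫ x, hInv h (γ x) ∂μ := by
    intro hγ hr
    have hf := (measurable_hInv_comp hmeas hinj hγ hr).aestronglyMeasurable
      (μ := (model m K μ).map (X 0))
    have e1 := integrable_map_measure hf (measurable_X 0).aemeasurable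
    have e2 := integral_map (measurable_X 0).aemeasurable hf
    rw [map_X_model] at e1 e2
    exact ⟨e1.symm, e2.symm⟩
  constructor
  · rintro ⟨h1, h2, h3, h4⟩
    exact ⟨h1, h2, (key h1 h2).1.1 h3, (key h1 h2).2 ▸ h4⟩
  · rintro ⟨h1, h2, h3, h4⟩
    exact ⟨h1, h2, (key h1 h2).1.2 h3, (key h1 h2).2.trans h4⟩

variable {h : Υ → ℝ} {r : D → Υ → ℝ}

/-- The measure with a given pair of densities. -/
theorem exists_model_of_mem (hmeas : Measurable h) (hinj : Function.Injective h)
    (hr : IsDerivVersion m (fun θ => L θ) (fun θ => K θ) r) (hac : ∀ᵐ θ ∂m, L θ ≪ K θ)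
    {γ : Υ → ℝ} {ξ : D → ℝ} (hγ : MemF (model m K μ) h γ) (hξ : MemR (model m K μ) ξ) :
    ∃ (_ : IsProbabilityMeasure (m.withDensity fun θ => ENNReal.ofReal (ξ θ)))
      (_ : IsProbabilityMeasure (μ.withDensity fun x => ENNReal.ofReal (hInv h (γ x)))),
      HasProgDensity (model (m.withDensity fun θ => ENNReal.ofReal (ξ θ)) L
        (μ.withDensity fun x => ENNReal.ofReal (hInv h (γ x)))) (model m K μ)
        (dens h γ ξ r (fun θ => L θ) (fun θ => K θ)) := by
  obtain ⟨g1, g2, g3, g4⟩ := (memF_model_iff hmeas hinj).1 hγ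
  obtain ⟨x1, x2, x3, x4⟩ := memR_model_iff.1 hξ
  refine ⟨isProbabilityMeasure_withDensity_ofReal x2 x3 x4,
    isProbabilityMeasure_withDensity_ofReal (.of_forall fun x => hInv_pos h _) g3 g4, ?_⟩
  have := isProbabilityMeasure_withDensity_ofReal x2 x3 x4
  have := isProbabilityMeasure_withDensity_ofReal (m := μ) (.of_forall fun x => hInv_pos h (γ x))
    g3 g4
  exact hasProgDensity_model L K (measurable_hInv_comp hmeas hinj g1 g2) hr.meas hac hr.ae_eq rfl
    x1 x2 rfl

theorem exists_densities (hmeas : Measurable h) (hinj : Function.Injective h)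
    (hr : IsDerivVersion m (fun θ => L θ) (fun θ => K θ) r)
    {Q : Measure (Path D)} (hQ : MemM (model m K μ) (fun θ => L θ) Q) :
    ∃ (γ : Υ → ℝ) (ξ : D → ℝ), MemF (model m K μ) h γ ∧ MemR (model m K μ) ξ ∧
      Q.map Θ = m.withDensity (fun θ => ENNReal.ofReal (ξ θ)) ∧
      HasProgDensity Q (model m K μ) (dens h γ ξ r (fun θ => L θ) (fun θ => K θ)) ∧
      ∀ (γ' : Υ → ℝ) (ξ' : D → ℝ), MemF (model m K μ) h γ' → MemR (model m K μ) ξ' →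
        HasProgDensity Q (model m K μ) (dens h γ' ξ' r (fun θ => L θ) (fun θ => K θ)) →
        γ' =ᵐ[μ] γ ∧ ξ' =ᵐ[m] ξ := by
  obtain ⟨m', i1, μ', i2, rfl, a1, a2, a3, a4, a5, a6⟩ := hQ.exists_eq_model
  obtain ⟨ξ, hξ, hξ0, hm'⟩ := exists_pos_density a1 a2
  obtain ⟨f, hf, hf0, hμ'⟩ := exists_pos_density a5 a6
  let γ : Υ → ℝ := fun x => h ⟨f x, hf0 x⟩
  have hγf : ∀ x, hInv h (γ x) = f x := fun x => hInv_apply hinj _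
  have hγ : Measurable γ := hmeas.comp hf.subtype_mk
  have hγr : ∀ x, γ x ∈ Set.range h := fun x => ⟨_, rfl⟩
  have hγF : MemF (model m K μ) h γ := by
    refine (memF_model_iff hmeas hinj).2 ⟨hγ, hγr, ?_⟩
    simp_rw [hγf]
    have : IsProbabilityMeasure (μ.withDensity fun x => ENNReal.ofReal (f x)) := hμ' ▸ i2
    exact integrable_and_integral_eq_one hf (.of_forall hf0)
  have hξR : MemR (model m K μ) ξ := by
    refine memR_model_iff.2 ⟨hξ, .of_forall hξ0, ?_⟩
    have : IsProbabilityMeasure (m.withDensity fun x => ENNReal.ofReal (ξ x)) := hm' ▸ i1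
    exact integrable_and_integral_eq_one hξ (.of_forall hξ0)
  refine ⟨γ, ξ, hγF, hξR, by rw [map_Θ_model]; exact hm', ?_, fun γ' ξ' hγ' hξ' hd => ?_⟩
  · refine hasProgDensity_model L K (by simp_rw [hγf]; exact hf) hr.meas a3 hr.ae_eq ?_
      hξ (.of_forall hξ0) hm'
    simp_rw [hγf]; exact hμ'
  -- A competing pair builds its own model with the same density process, hence the same measure.
  -- Comparing the laws of `Θ` and `X 0` identifies the densities.
  · obtain ⟨j1, j2, hd'⟩ := exists_model_of_mem hmeas hinj hr a3 hγ' hξ'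
    have heq := hd.eq hd'
    obtain ⟨g1, g2, g3, -⟩ := (memF_model_iff hmeas hinj).1 hγ'
    obtain ⟨x1, x2, x3, -⟩ := memR_model_iff.1 hξ'
    have e1 := congrArg (fun Q => Q.map Θ) heq
    have e2 := congrArg (fun Q => Q.map (X 0)) heq
    simp only [map_Θ_model, map_X_model] at e1 e2
    rw [hm'] at e1
    rw [hμ'] at e2
    refine ⟨?_, ae_eq_of_withDensity_ofReal_eq x1 hξ x2 (.of_forall hξ0) x3 e1.symm⟩
    filter_upwards [ae_eq_of_withDensity_ofReal_eq (measurable_hInv_comp hmeas hinj g1 g2) hf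
      (.of_forall fun x => hInv_pos h _) (.of_forall hf0) g3 e2.symm] with x hx
    exact eq_of_hInv_eq hinj (g2 x) (hγr x) (hx.trans (hγf x).symm)

/-- `L θ ≪ K θ` yields the measure and its density; `K θ ≪ L θ` is what makes `P` progressively
absolutely continuous with respect to it. -/
theorem existsUnique_measure (hmeas : Measurable h) (hinj : Function.Injective h)
    (hr : IsDerivVersion m (fun θ => L θ) (fun θ => K θ) r)
    (hequiv : ∀ᵐ θ ∂m, L θ ≪ K θ ∧ K θ ≪ L θ) {γ : Υ → ℝ} {ξ : D → ℝ}
    (hγ : MemF (model m K μ) h γ) (hξ : MemR (model m K μ) ξ) :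
    ∃ Q : Measure (Path D), MemM (model m K μ) (fun θ => L θ) Q ∧
      HasProgDensity Q (model m K μ) (dens h γ ξ r (fun θ => L θ) (fun θ => K θ)) ∧
      ∀ Q' : Measure (Path D), IsProbabilityMeasure Q' →
        HasProgDensity Q' (model m K μ) (dens h γ ξ r (fun θ => L θ) (fun θ => K θ)) →
        Q' = Q := by
  have hac := hequiv.mono fun θ h => h.1
  obtain ⟨j1, j2, hd⟩ := exists_model_of_mem hmeas hinj hr hac hγ hξ
  obtain ⟨g1, g2, -, -⟩ := (memF_model_iff hmeas hinj).1 hγ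
  obtain ⟨x1, x2, -, -⟩ := memR_model_iff.1 hξ
  refine ⟨_, memM_model (withDensity_absolutelyContinuous _ _)
    (absolutelyContinuous_withDensity_ofReal x1 x2) hac (hequiv.mono fun θ h => h.2)
    (withDensity_absolutelyContinuous _ _) (absolutelyContinuous_withDensity_ofReal
      (measurable_hInv_comp hmeas hinj g1 g2) (.of_forall fun x => hInv_pos h _)), hd,
    fun Q' _ hQ' => hQ'.eq hd⟩

theorem exists_rcp (hmeas : Measurable h) (hinj : Function.Injective h)
    (hr : IsDerivVersion m (fun θ => L θ) (fun θ => K θ) r)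
    {p : D → Measure (Path D)} (hp : IsConsistentRCP (model m K μ) p)
    {Q : Measure (Path D)} {γ : Υ → ℝ} {ξ : D → ℝ}
    (hQ : MemM (model m K μ) (fun θ => L θ) Q) (hγ : MemF (model m K μ) h γ)
    (hξ : MemR (model m K μ) ξ)
    (hd : HasProgDensity Q (model m K μ) (dens h γ ξ r (fun θ => L θ) (fun θ => K θ))) :
    ∃ q : D → Measure (Path D), IsConsistentRCP Q q ∧
      (∀ q' : D → Measure (Path D), IsConsistentRCP Q q' →
        ∀ᵐ θ ∂(Q.map Θ), q' θ = q θ) ∧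
      ∀ᵐ θ ∂m, MemMFiber (p θ) (L θ) (q θ) ∧
        HasProgDensity (q θ) (p θ) (densFiber h γ r (fun θ => L θ) (fun θ => K θ) θ) := by
  have hQp := hQ.prob
  obtain ⟨-, -, -, -, -, -, -, a3, a4, -, -⟩ := hQ.exists_eq_model
  obtain ⟨j1, j2, hd'⟩ := exists_model_of_mem hmeas hinj hr a3 hγ hξ
  -- `Q` becomes the model of the given pair, so its fibres carry this very `γ`.
  obtain rfl := hd.eq hd'
  obtain ⟨g1, g2, -, -⟩ := (memF_model_iff hmeas hinj).1 hγ
  have hgm := measurable_hInv_comp hmeas hinj g1 g2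
  have hrcp := isConsistentRCP_model (m.withDensity fun θ => ENNReal.ofReal (ξ θ)) L
    (μ.withDensity fun x => ENNReal.ofReal (hInv h (γ x)))
  refine ⟨_, hrcp, fun q' hq' => hq'.ae_eq hrcp, ?_⟩
  -- The prescribed `p` is arbitrary, but almost everywhere it is the renewal fibre.
  have hpe := hp.ae_eq (isConsistentRCP_model m K μ)
  rw [map_Θ_model] at hpe
  filter_upwards [hpe, a3, a4, hr.ae_eq] with θ h1 h2 h3 h4
  rw [h1]
  refine ⟨⟨inferInstance, progEquiv_iff.2 ⟨progAC_fiber h2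
    (withDensity_absolutelyContinuous _ _) θ, progAC_fiber h3
    (absolutelyContinuous_withDensity_ofReal hgm (.of_forall fun x => hInv_pos h _)) θ⟩,
    isCRP_fiber _ _ θ⟩, hasProgDensity_fiber L K hgm hr.meas h2 h4 rfl⟩

end Model

end CMRP

theorem mainTheorem1 {d k : ℕ} (D : Set (Fin d → ℝ))
    -- the interarrival time distributions `K(θ)` and `Λ(ρ(θ))`
    (K : Kernel D CMRP.Υ) [IsMarkovKernel K]
    (ρ : D → (Fin k → ℝ)) (hρ : Measurable ρ)
    (Λ : (Fin k → ℝ) → Measure CMRP.Υ)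
    (hΛ : ∀ θ, IsProbabilityMeasure (Λ (ρ θ))) (hΛm : Measurable fun θ => Λ (ρ θ))
    (h : CMRP.Υ → ℝ) (hmeas : Measurable h) (hinj : Function.Injective h)
    -- the initial measure and its regular conditional probabilities
    (P : Measure (CMRP.Path D)) [IsProbabilityMeasure P]
    (ha1 : CMRP.CondIndepWX P) (ha2 : CMRP.IndepThetaX P)
    (hP : CMRP.IsCMRP P (fun θ => K θ))
    (p : D → Measure (CMRP.Path D)) (hp : CMRP.IsConsistentRCP P p)
    -- a jointly measurable version of `dΛ(ρ(θ))/dK(θ)`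
    (r : D → CMRP.Υ → ℝ)
    (hr : CMRP.IsDerivVersion (P.map CMRP.Θ) (fun θ => Λ (ρ θ)) (fun θ => K θ) r) :
    -- (i)
    (∀ Q : Measure (CMRP.Path D), CMRP.MemM P (fun θ => Λ (ρ θ)) Q →
      ∃ (γ : CMRP.Υ → ℝ) (ξ : D → ℝ), CMRP.MemF P h γ ∧ CMRP.MemR P ξ ∧
        Q.map CMRP.Θ = (P.map CMRP.Θ).withDensity (fun θ => ENNReal.ofReal (ξ θ)) ∧
        CMRP.HasProgDensity Q P (CMRP.dens h γ ξ r (fun θ => Λ (ρ θ)) (fun θ => K θ)) ∧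
        ∀ (γ' : CMRP.Υ → ℝ) (ξ' : D → ℝ), CMRP.MemF P h γ' → CMRP.MemR P ξ' →
          CMRP.HasProgDensity Q P (CMRP.dens h γ' ξ' r (fun θ => Λ (ρ θ)) (fun θ => K θ)) →
          γ' =ᵐ[P.map (CMRP.X 0)] γ ∧ ξ' =ᵐ[P.map CMRP.Θ] ξ) ∧
    -- (ii)
    ((∀ᵐ θ ∂(P.map CMRP.Θ), Λ (ρ θ) ≪ K θ ∧ K θ ≪ Λ (ρ θ)) →
      ∀ (γ : CMRP.Υ → ℝ) (ξ : D → ℝ), CMRP.MemF P h γ → CMRP.MemR P ξ →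
        ∃ Q : Measure (CMRP.Path D), CMRP.MemM P (fun θ => Λ (ρ θ)) Q ∧
          CMRP.HasProgDensity Q P (CMRP.dens h γ ξ r (fun θ => Λ (ρ θ)) (fun θ => K θ)) ∧
          ∀ Q' : Measure (CMRP.Path D), IsProbabilityMeasure Q' →
            CMRP.HasProgDensity Q' P (CMRP.dens h γ ξ r (fun θ => Λ (ρ θ)) (fun θ => K θ)) →
            Q' = Q) ∧
    -- (iii)
    (∀ (Q : Measure (CMRP.Path D)) (γ : CMRP.Υ → ℝ) (ξ : D → ℝ),
      CMRP.MemM P (fun θ => Λ (ρ θ)) Q → CMRP.MemF P h γ → CMRP.MemR P ξ →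
      CMRP.HasProgDensity Q P (CMRP.dens h γ ξ r (fun θ => Λ (ρ θ)) (fun θ => K θ)) →
      ∃ q : D → Measure (CMRP.Path D), CMRP.IsConsistentRCP Q q ∧
        (∀ q' : D → Measure (CMRP.Path D), CMRP.IsConsistentRCP Q q' →
          ∀ᵐ θ ∂(Q.map CMRP.Θ), q' θ = q θ) ∧
        ∀ᵐ θ ∂(P.map CMRP.Θ), CMRP.MemMFiber (p θ) (Λ (ρ θ)) (q θ) ∧
          CMRP.HasProgDensity (q θ) (p θ)
            (CMRP.densFiber h γ r (fun θ => Λ (ρ θ)) (fun θ => K θ) θ)) := by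
  let L : Kernel D CMRP.Υ := ⟨fun θ => Λ (ρ θ), hΛm⟩
  have hL : IsMarkovKernel L := ⟨hΛ⟩
  have i1 : IsProbabilityMeasure (P.map CMRP.Θ) :=
    Measure.isProbabilityMeasure_map CMRP.measurable_Θ.aemeasurable
  have i2 : IsProbabilityMeasure (P.map (CMRP.X 0)) :=
    Measure.isProbabilityMeasure_map (CMRP.measurable_X 0).aemeasurable
  -- Once `P` is replaced by its model, the assertions concern explicit product mixtures only.
  obtain ⟨m, μ, _, _, rfl⟩ : ∃ (m : Measure D) (μ : Measure CMRP.Υ) (_ : IsProbabilityMeasure m)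
      (_ : IsProbabilityMeasure μ), P = CMRP.model m K μ :=
    ⟨_, _, i1, i2, hP.eq_model ha1 ha2 rfl rfl⟩
  rw [CMRP.map_Θ_model] at hr ⊢
  rw [CMRP.map_X_model]
  exact ⟨fun Q hQ => CMRP.exists_densities (L := L) hmeas hinj hr hQ,
    fun hequiv γ ξ hγ hξ => CMRP.existsUnique_measure (L := L) hmeas hinj hr hequiv hγ hξ,
    fun Q γ ξ hQ hγ hξ hd => CMRP.exists_rcp (L := L) hmeas hinj hr hp hQ hγ hξ hd⟩
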